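/- Let $\mu$ be Lebesgue measure on $X=\mathbb{R}_+=(0,\infty)$ with its Borel $\sigma$-algebra $\mathcal{B}$. Let $X^*$ be the space of countable subsets of $X$ with the $\sigma$-algebra $\mathcal{B}^*$ generated by the events $[|\omega\cap B|=n]$ ($B\in\mathcal{B}$, $n\ge 0$), and let $\mu^*$ be the law on $X^*$ of the Poisson point process with intensity $\mu$: the numbers $|\omega\cap A_i|$ of points in pairwise disjoint Borel sets $A_i$ are independent and Poisson distributed with expectations $\mu(A_i)$. For $T:X\to X$ put $T_*(\omega)=\{T(x):x\in\omega\}$. Let $t_1(\omega)=\inf\omega$, $$\kappa(\omega)=\inf\{k\ge 1: t_1(T_*^k(\omega))=T^k(t_1(\omega))\}\in\mathbb{N}\cup\{+\infty\},\qquad T_*^\kappa(\omega)=T_*^{\kappa(\omega)}(\omega)$$ ($T_*^\kappa$ is the leftmost position transformation), and let $$X_0=\{(x,\omega)\in X\times X^*:\ \omega\cap(0,x]=\emptyset\}.$$ Let $T:\mathbb{R}_+\to\mathbb{R}_+$ be a conservative map preserving $\mu$ (not necessarily invertible or ergodic). Then: 1. The leftmost position transformation is well defined: for $\mu^*$-almost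 every $\omega$, $t_1(\omega)$ is the least element of $\omega$ and $\kappa(\omega)<\infty$. 2. The set $X_0$ is measurable modulo $\mu\times\mu^*$-null sets and $(\mu\times\mu^*)(X_0)=1$. So, with $\mathcal{B}_0=(\mathcal{B}\otimes\mathcal{B}^*)\cap X_0$ and $\mu_0$ the restriction of $\mu\times\mu^*$ to $X_0$, $(X_0,\mathcal{B}_0,\mu_0)$ is a probability space. The first return time $\varphi_{X_0}(p)=\min\{n\ge1:(T\times T_*)^n(p)\in X_0\}$ is finite for $\mu_0$-almost every $p\in X_0$, so that the induced map $(T\times T_*)_{X_0}(p)=(T\times T_*)^{\varphi_{X_0}(p)}(p)$ is defined almost everywhere. 3. The map $(x,\omega)\mapsto\{x\}\cup\omega$ from $X_0$ to $X^*$ is an isomorphism of measure-preserving systems, modulo null sets, $$\left(X_0,\mathcal{B}_0,\mu_0,(T\times T_*)_{X_0}\right)\cong\left(X^*,\mathcal{B}^*,\mu^*,T_*^\kappa\right).$$ That is, there are measurable forward invariant sets of full measure in $X_0$ and in $X^*$ on which the two transformations are measurable and measure preserving, and between which the map restricts to a bimeasurable, measure-preserving bijection intertwining the two transformations. -/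

import Mathlib

open MeasureTheory Set

noncomputable section

/-- The space `X^*` of countable subsets of `X`. -/
@[ext]
structure CountableConfig (X : Type*) where
  /-- the set of points of the configuration -/
  carrier : Set X
  countable : carrier.Countable

namespace CountableConfig

/-- The number of points `|ω ∩ B|` of `ω` lying in `B`, with values in `ℕ ∪ {∞}`. -/
def count {X : Type*} (B : Set X) (ω : CountableConfig X) : ℕ∞ :=
  (ω.carrier ∩ B).encard

/-- The σ-algebra `𝓑^*` generated by the events `[|ω ∩ B| = n]`, with `B` measurable, `n : ℕ`. -/
instance {X : Type*} [MeasurableSpace X] : MeasurableSpace (CountableConfig X) :=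
  MeasurableSpace.generateFrom
    {E | ∃ (B : Set X) (n : ℕ), MeasurableSet B ∧ E = {ω | ω.count B = (n : ℕ∞)}}

/-- The map `T_* : X^* → X^*`, `T_*(ω) = {T x : x ∈ ω}`. -/
def suspension {X : Type*} (T : X → X) (ω : CountableConfig X) : CountableConfig X :=
  ⟨T '' ω.carrier, ω.countable.image T⟩

/-- The map `π(x, ω) = {x} ∪ ω`. -/
def adjoin {X : Type*} (p : X × CountableConfig X) : CountableConfig X :=
  ⟨{p.1} ∪ p.2.carrier, (countable_singleton p.1).union p.2.countable⟩

end CountableConfig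

/-- `P` is the law of the Poisson point process with intensity `μ`: the numbers of points in
pairwise disjoint measurable sets are independent, and the number of points in `A` is Poisson
distributed with expectation `μ A` (almost surely infinite if `μ A = ∞`). -/
structure IsPoissonLaw {X : Type*} [MeasurableSpace X] (μ : Measure X)
    (P : Measure (CountableConfig X)) : Prop where
  indep : ∀ (n : ℕ) (A : Fin n → Set X), (∀ i, MeasurableSet (A i)) →
    Pairwise (fun i j => Disjoint (A i) (A j)) →
    ProbabilityTheory.iIndepFun (fun i => CountableConfig.count (A i)) P
  count_eq : ∀ A : Set X, MeasurableSet A → μ A ≠ ⊤ → ∀ k : ℕ,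
    P {ω | ω.count A = (k : ℕ∞)} =
      ENNReal.ofReal (Real.exp (-(μ A).toReal) * (μ A).toReal ^ k / (k.factorial : ℝ))
  count_eq_of_top : ∀ A : Set X, MeasurableSet A → μ A = ⊤ → ∀ k : ℕ,
    P {ω | ω.count A = (k : ℕ∞)} = 0

open Classical in
/-- The measure `μ^*` on `X^*`: the law of the Poisson point process with intensity `μ`
(the zero measure if `μ` is such that there is no such law). -/
def poissonLaw {X : Type*} [MeasurableSpace X] (μ : Measure X) : Measure (CountableConfig X) :=
  if h : ∃ P : Measure (CountableConfig X), IsPoissonLaw μ P then h.choose else 0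

/-- The first return time `φ_A(y) = inf {n ≥ 1 : S^n y ∈ A}`, equal to `∞` if there is no return. -/
def firstReturnTime {Y : Type*} (S : Y → Y) (A : Set Y) (y : Y) : ℕ∞ :=
  ⨅ (n : ℕ) (_ : 1 ≤ n ∧ S^[n] y ∈ A), (n : ℕ∞)

theorem iterate_firstReturnTime_mem {Y : Type*} (S : Y → Y) (A : Set Y) (y : A) :
    S^[(firstReturnTime S A y).toNat] (y : Y) ∈ A := by
  classical
  by_cases h : ∃ n : ℕ, 1 ≤ n ∧ S^[n] (y : Y) ∈ A
  · have : firstReturnTime S A y = ((Nat.find h : ℕ) : ℕ∞) := by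
      apply le_antisymm
      · exact iInf₂_le (Nat.find h) (Nat.find_spec h)
      · exact le_iInf₂ fun n hn => by exact_mod_cast Nat.find_min' h hn
    rw [this, ENat.toNat_natCast]
    exact (Nat.find_spec h).2
  · have : firstReturnTime S A y = ⊤ := by
      simp only [firstReturnTime, iInf_eq_top]
      exact fun n hn => absurd ⟨n, hn⟩ h
    simp [this]

/-- The induced transformation `S_A(y) = S^{φ_A(y)}(y)` of `A` (the identity where `φ_A = ∞`). -/
def inducedMap {Y : Type*} (S : Y → Y) (A : Set Y) (y : A) : A :=
  ⟨S^[(firstReturnTime S A y).toNat] y, iterate_firstReturnTime_mem S A y⟩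

/-- `Φ` is an isomorphism, modulo null sets, of the measure preserving system `(α, μ, S)` onto the
measure preserving system `(β, ν, R)`: there are measurable forward invariant sets `A ⊆ α`,
`B ⊆ β` of full measure such that `S` and `R` restrict to (measurable) measure preserving self-maps
of `A` and `B`, and `Φ` restricts to a bimeasurable, measure preserving bijection `A → B` that
intertwines these self-maps. -/
def IsSystemIsomorphism {α β : Type*} [MeasurableSpace α] [MeasurableSpace β]
    (μ : Measure α) (S : α → α) (ν : Measure β) (R : β → β) (Φ : α → β) : Prop :=
  ∃ (A : Set α) (B : Set β) (hA : MapsTo S A A) (hB : MapsTo R B B) (e : A ≃ᵐ B),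
    MeasurableSet A ∧ MeasurableSet B ∧ μ Aᶜ = 0 ∧ ν Bᶜ = 0 ∧
    MeasurePreserving (hA.restrict S A A)
      (μ.comap (Subtype.val : A → α)) (μ.comap (Subtype.val : A → α)) ∧
    MeasurePreserving (hB.restrict R B B)
      (ν.comap (Subtype.val : B → β)) (ν.comap (Subtype.val : B → β)) ∧
    MeasurePreserving e (μ.comap (Subtype.val : A → α)) (ν.comap (Subtype.val : B → β)) ∧
    (∀ a : A, (e a : β) = Φ a) ∧
    ∀ a : A, e (hA.restrict S A A a) = hB.restrict R B B (e a)

/-- The set `ℝ_+` of positive real numbers. -/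
abbrev PosReal : Type := Set.Ioi (0 : ℝ)

/-- Lebesgue measure on `ℝ_+`. -/
def posLebesgue : Measure PosReal :=
  (volume : Measure ℝ).comap (Subtype.val : PosReal → ℝ)

/-- `t_1(ω) = inf ω`, with the value `1` where the infimum is not a positive real number, that is,
where `ω` is empty or accumulates at `0`. -/
def leftmostPoint (ω : CountableConfig PosReal) : PosReal :=
  if h : 0 < sInf ((Subtype.val : PosReal → ℝ) '' ω.carrier) then
    ⟨sInf ((Subtype.val : PosReal → ℝ) '' ω.carrier), h⟩
  else ⟨1, Set.mem_Ioi.mpr one_pos⟩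

/-- The leftmost return time `κ(ω) = inf {k ≥ 1 : t_1(T_*^k ω) = T^k (t_1 ω)}`. -/
def leftmostReturnTime (T : PosReal → PosReal) (ω : CountableConfig PosReal) : ℕ∞ :=
  ⨅ (k : ℕ) (_ : 1 ≤ k ∧
    leftmostPoint ((CountableConfig.suspension T)^[k] ω) = T^[k] (leftmostPoint ω)), (k : ℕ∞)

/-- The leftmost position transformation `T_*^κ(ω) = T_*^{κ(ω)}(ω)`
(the identity where `κ = ∞`). -/
def leftmostTransformation (T : PosReal → PosReal) (ω : CountableConfig PosReal) :
    CountableConfig PosReal :=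
  (CountableConfig.suspension T)^[(leftmostReturnTime T ω).toNat] ω

/-- The Poisson product `T × T_*`. -/
def poissonProduct {X : Type*} (T : X → X) : X × CountableConfig X → X × CountableConfig X :=
  Prod.map T (CountableConfig.suspension T)

/-- The set `X_0 = {(x, ω) : ω ∩ (0, x] = ∅}`. -/
def leftmostSet : Set (PosReal × CountableConfig PosReal) :=
  {p | p.2.carrier ∩ Set.Iic p.1 = ∅}

/-- The product measure `μ × μ^*`, for `μ` Lebesgue measure on `ℝ_+`. -/
def productMeasure : Measure (PosReal × CountableConfig PosReal) :=
  posLebesgue.prod (poissonLaw posLebesgue)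

/-- The measure `μ_0` on `X_0` (with the trace of the product σ-algebra) obtained by restricting
`μ × μ^*` to `X_0`. -/
def leftmostSetMeasure : Measure leftmostSet :=
  productMeasure.comap (Subtype.val : leftmostSet → PosReal × CountableConfig PosReal)

end

/-! Removing the leftmost point, ω ↦ (t₁(ω), ω \ {t₁(ω)}), inverts π(x, ω) = {x} ∪ ω. For the
Poisson process t₁ has density e^{-x} and, given t₁ = x, the remaining points form a Poisson process
on (x, ∞). The measure μ × μ^* on X₀ has the same description, because (0, x] is empty with
probability e^{-x}. Hence π carries μ₀ to μ^* (`map_splitLeftmost`, `map_regularAdjoin`).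
Conditioning is avoided: on a fine mesh, the identity Poisson(a){1} = a · Poisson(a){0} trades the
single point in the first occupied cell for a Lebesgue point of that cell
(`measure_iUnion_meshEvent`), and the mesh is then refined.

Moreover π intertwines T × T_* with T_*. When T^k is injective on {x} ∪ ω, the point T^k x is
leftmost in T_*^k({x} ∪ ω) exactly when (T × T_*)^k(x, ω) lies in X₀
(`leftmostPoint_iterate_suspension_iff`). So κ ∘ π is the return time to X₀, and π conjugates the
two induced transformations. Returns occur almost surely because T × T_* is conservative, T being
conservative and T_* preserving a probability measure (`Conservative.prodMap`). The induced map
preserves μ₀ since μ₀ is finite (`measurePreserving_returnMap`).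

As T need not be injective, T_* may merge points. Everything is therefore done on `regularConfigs
T`, a measurable forward invariant set of full measure: its members are infinite and every T^k is
injective and locally finite on them. There the counts of T_*ω are counts of ω on preimages, so T_*
agrees with a measurable map, which preserves μ^* by uniqueness of the Poisson law
(`IsPoissonLaw.ext`). Existence of that law is also proved, by superposing independent processes on
unit intervals. -/

open MeasureTheory Set ProbabilityTheory
open scoped NNReal ENNReal

/-! ### Counting maps and the σ-algebra on configurations -/

namespace CountableConfig

variable {X : Type*}

theorem count_iUnion {ι : Type*} [Fintype ι] {A : ι → Set X}
    (hA : Pairwise fun i j => Disjoint (A i) (A j)) (ω : CountableConfig X) :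
    count (⋃ i, A i) ω = ∑ i, count (A i) ω := by
  rw [count, inter_iUnion, encard_iUnion_of_finite, finsum_eq_sum_of_fintype]
  · rfl
  · exact fun i j hij => ((hA hij).inter_left' _).inter_right' _

theorem count_mono {A B : Set X} (h : A ⊆ B) (ω : CountableConfig X) : count A ω ≤ count B ω :=
  encard_le_encard (inter_subset_inter_right _ h)

theorem count_union {A B : Set X} (h : Disjoint A B) (ω : CountableConfig X) :
    count (A ∪ B) ω = count A ω + count B ω := by
  rw [count, inter_union_distrib_left, encard_union_eq]
  · rfl
  · exact (h.inter_left' _).inter_right' _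

theorem count_eq_zero {A : Set X} {ω : CountableConfig X} :
    count A ω = 0 ↔ ∀ x ∈ ω.carrier, x ∉ A := by
  rw [count, encard_eq_zero, eq_empty_iff_forall_notMem]
  exact ⟨fun h x hx hA => h x ⟨hx, hA⟩, fun h x hx => h x hx.1 hx.2⟩

theorem count_le_one {A : Set X} {ω : CountableConfig X} :
    count A ω ≤ 1 ↔ ∀ x ∈ ω.carrier, ∀ y ∈ ω.carrier, x ∈ A → y ∈ A → x = y := by
  rw [count, encard_le_one_iff]
  exact ⟨fun h x hx y hy hxA hyA => h x y ⟨hx, hxA⟩ ⟨hy, hyA⟩,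
    fun h x y hx hy => h x hx.1 y hy.1 hx.2 hy.2⟩

/-- Points are additive over the fibres of a finer labelling; this expresses two labellings through
a common refinement. -/
theorem count_preimage_fiber {ι κ : Type*} [Fintype ι] (l : X → ι) (f : ι → κ)
    (s : Set κ) [DecidablePred fun i => f i ∈ s] (ω : CountableConfig X) :
    count ((fun x => f (l x)) ⁻¹' s) ω = ∑ i with f i ∈ s, count (l ⁻¹' {i}) ω := by
  rw [Finset.sum_subtype (p := fun i => f i ∈ s) _ (by simp), ← count_iUnion]
  · congr 1
    ext x
    simp
  · intro i j hij
    exact Disjoint.preimage _ (by simpa [Subtype.ext_iff, eq_comm] using hij)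

section Measurable

variable [MeasurableSpace X]

theorem measurableSet_count_eq {B : Set X} (hB : MeasurableSet B) (n : ℕ) :
    MeasurableSet {ω : CountableConfig X | ω.count B = n} :=
  MeasurableSpace.measurableSet_generateFrom ⟨B, n, hB, rfl⟩

@[fun_prop]
theorem measurable_count {B : Set X} (hB : MeasurableSet B) :
    Measurable (count B : CountableConfig X → ℕ∞) := by
  refine measurable_to_countable' fun n => ?_
  induction n using ENat.recTopCoe with
  | coe n => exact measurableSet_count_eq hB n
  | top =>
    have : (count B ⁻¹' {⊤} : Set (CountableConfig X)) =
        (⋃ n : ℕ, {ω : CountableConfig X | ω.count B = n})ᶜ := by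
      ext ω
      simp only [mem_preimage, mem_singleton_iff, mem_compl_iff, mem_iUnion, mem_ofPred_eq,
        not_exists]
      exact ENat.eq_top_iff_forall_ne.trans (forall_congr' fun _ => ne_comm)
    rw [this]
    exact (MeasurableSet.iUnion fun n => measurableSet_count_eq hB n).compl

theorem measurable_of_count {α : Type*} [MeasurableSpace α] {f : α → CountableConfig X}
    (h : ∀ B, MeasurableSet B → Measurable fun a => count B (f a)) : Measurable f := by
  refine measurable_generateFrom ?_
  rintro _ ⟨B, n, hB, rfl⟩
  exact h B hB (measurableSet_singleton (n : ℕ∞))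

/-- The numbers of points of `ω` in the fibres of `l`. -/
noncomputable def counts {ι : Type*} (l : X → ι) (ω : CountableConfig X) (i : ι) : ℕ∞ :=
  count (l ⁻¹' {i}) ω

theorem measurable_counts {ι : Type*} {l : X → ι} (hl : ∀ i, MeasurableSet (l ⁻¹' {i})) :
    Measurable (counts l) :=
  measurable_pi_lambda _ fun i => measurable_count (hl i)

/-- Events determined by the counts over a finite measurable partition form a π-system, since two
partitions have a common refinement labelled by pairs. The space of count vectors is countable, so
agreement at single vectors is enough. -/
theorem ext_of_counts {P Q : Measure (CountableConfig X)} [IsFiniteMeasure P]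
    (h : ∀ (ι : Type) [Fintype ι] (l : X → ι), (∀ i, MeasurableSet (l ⁻¹' {i})) →
      ∀ k : ι → ℕ∞, P (counts l ⁻¹' {k}) = Q (counts l ⁻¹' {k})) : P = Q := by
  have key : ∀ (ι : Type) [Fintype ι] (l : X → ι), (∀ i, MeasurableSet (l ⁻¹' {i})) →
      ∀ S : Set (ι → ℕ∞), P (counts l ⁻¹' S) = Q (counts l ⁻¹' S) := by
    intro ι _ l hl S
    have : P.map (counts l) = Q.map (counts l) := by
      refine Measure.ext_of_singleton fun k => ?_
      rw [Measure.map_apply (measurable_counts hl) (measurableSet_singleton k),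
        Measure.map_apply (measurable_counts hl) (measurableSet_singleton k), h ι l hl k]
    have hS : MeasurableSet S := S.to_countable.measurableSet
    rw [← Measure.map_apply (measurable_counts hl) hS, this,
      Measure.map_apply (measurable_counts hl) hS]
  let C : Set (Set (CountableConfig X)) := {E | ∃ (ι : Type) (_ : Fintype ι) (l : X → ι)
    (S : Set (ι → ℕ∞)), (∀ i, MeasurableSet (l ⁻¹' {i})) ∧ E = counts l ⁻¹' S}
  refine ext_of_generate_finite C ?_ ?_ ?_ ?_
  · apply le_antisymm
    · refine MeasurableSpace.generateFrom_le ?_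
      rintro _ ⟨B, n, hB, rfl⟩
      -- The two-element label type `Prop` encodes the partition into `B` and its complement.
      refine MeasurableSpace.measurableSet_generateFrom
        ⟨Prop, inferInstance, fun x => x ∈ B, {k | k True = n}, fun i => ?_, ?_⟩
      · exact (measurable_mem.2 hB) (measurableSet_singleton i)
      · ext ω
        simp only [mem_ofPred_eq, mem_preimage, counts]
        congr! 2
        ext x
        simp
    · refine MeasurableSpace.generateFrom_le ?_
      rintro _ ⟨ι, _, l, S, hl, rfl⟩
      exact measurable_counts hl S.to_countable.measurableSet
  · classical
    rintro _ ⟨ι, _, l, S, hl, rfl⟩ _ ⟨κ, _, l', S', hl', rfl⟩ -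
    refine ⟨ι × κ, inferInstance, fun x => (l x, l' x),
      {k | (fun i => ∑ p : ι × κ with p.1 ∈ ({i} : Set ι), k p) ∈ S ∧
        (fun i => ∑ p : ι × κ with p.2 ∈ ({i} : Set κ), k p) ∈ S'}, fun i => ?_, ?_⟩
    · have : (fun x => (l x, l' x)) ⁻¹' {i} = l ⁻¹' {i.1} ∩ l' ⁻¹' {i.2} := by
        ext x
        simp [Prod.ext_iff]
      rw [this]
      exact (hl _).inter (hl' _)
    · ext ω
      simp only [mem_inter_iff, mem_preimage, mem_ofPred_eq]
      have h1 : counts l ω = fun i => ∑ p : ι × κ with p.1 ∈ ({i} : Set ι),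
          counts (fun x => (l x, l' x)) ω p := funext fun i =>
        count_preimage_fiber (fun x => (l x, l' x)) Prod.fst {i} ω
      have h2 : counts l' ω = fun i => ∑ p : ι × κ with p.2 ∈ ({i} : Set κ),
          counts (fun x => (l x, l' x)) ω p := funext fun i =>
        count_preimage_fiber (fun x => (l x, l' x)) Prod.snd {i} ω
      rw [← h1, ← h2]
  · rintro _ ⟨ι, _, l, S, hl, rfl⟩
    exact key ι l hl S
  · exact key Unit (fun _ => ()) (fun i => by simp) univ

end Measurable

end CountableConfig

/-! ### Poisson distributions with values in ℕ ∪ {∞}, and uniqueness of the Poisson law -/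

open CountableConfig

/-- The Poisson distribution on `ℕ ∪ {∞}` with expectation `a ∈ [0, ∞]`. -/
noncomputable def extPoisson (a : ℝ≥0∞) : Measure ℕ∞ :=
  if a = ⊤ then Measure.dirac ⊤ else (poissonMeasure a.toNNReal).map (Nat.cast : ℕ → ℕ∞)

theorem extPoisson_top : extPoisson ⊤ = Measure.dirac ⊤ := if_pos rfl

theorem extPoisson_of_ne_top {a : ℝ≥0∞} (ha : a ≠ ⊤) :
    extPoisson a = (poissonMeasure a.toNNReal).map (Nat.cast : ℕ → ℕ∞) := if_neg ha

instance (a : ℝ≥0∞) : IsProbabilityMeasure (extPoisson a) := by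
  unfold extPoisson
  split_ifs
  · infer_instance
  · exact Measure.isProbabilityMeasure_map (by fun_prop)

theorem extPoisson_singleton {a : ℝ≥0∞} (ha : a ≠ ⊤) (k : ℕ) :
    extPoisson a {(k : ℕ∞)} =
      ENNReal.ofReal (Real.exp (-a.toReal) * a.toReal ^ k / (k.factorial : ℝ)) := by
  rw [extPoisson_of_ne_top ha, Measure.map_apply (by fun_prop) (measurableSet_singleton _)]
  have : (Nat.cast : ℕ → ℕ∞) ⁻¹' {(k : ℕ∞)} = {k} := by ext; simp
  rw [this, poissonMeasure_singleton]
  rfl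

theorem extPoisson_singleton_top {a : ℝ≥0∞} (ha : a ≠ ⊤) : extPoisson a {⊤} = 0 := by
  rw [extPoisson_of_ne_top ha, Measure.map_apply (by fun_prop) (measurableSet_singleton _)]
  have : (Nat.cast : ℕ → ℕ∞) ⁻¹' {⊤} = ∅ := by ext; simp
  rw [this, measure_empty]

/-- The finite values determine the mass at ∞, because both total masses are one. -/
theorem eq_extPoisson {a : ℝ≥0∞} {Q : Measure ℕ∞} [IsProbabilityMeasure Q]
    (h : ∀ k : ℕ, Q {(k : ℕ∞)} = extPoisson a {(k : ℕ∞)}) : Q = extPoisson a := by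
  have hc : ∀ R : Measure ℕ∞, R {⊤}ᶜ = ∑' k : ℕ, R {(k : ℕ∞)} := fun R => by
    have : ({⊤}ᶜ : Set ℕ∞) = ⋃ k : ℕ, {(k : ℕ∞)} := by
      ext n
      rw [mem_compl_singleton_iff, ENat.ne_top_iff_exists]
      simp only [mem_iUnion, mem_singleton_iff, eq_comm]
    rw [this, measure_iUnion _ fun k => measurableSet_singleton _]
    intro i j hij
    simpa using hij
  refine Measure.ext_of_singleton fun k => ?_
  induction k using ENat.recTopCoe with
  | coe k => exact h k
  | top =>
    have h1 : ∀ (R : Measure ℕ∞) [IsProbabilityMeasure R], R {⊤} = 1 - R {⊤}ᶜ := fun R _ => by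
      rw [← prob_compl_eq_one_sub (measurableSet_singleton _).compl, compl_compl]
    rw [h1 Q, h1 (extPoisson a), hc, hc]
    simp only [h]

namespace IsPoissonLaw

variable {X : Type*} [MeasurableSpace X] {μ : Measure X} {P : Measure (CountableConfig X)}

/-- Independence of the empty family already forces the total mass to be an empty product. -/
theorem isProbabilityMeasure (h : IsPoissonLaw μ P) : IsProbabilityMeasure P :=
  (h.indep 0 (fun _ => ∅) (fun _ => .empty) fun i => i.elim0).isProbabilityMeasure

theorem map_count (h : IsPoissonLaw μ P) {A : Set X} (hA : MeasurableSet A) :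
    P.map (count A) = extPoisson (μ A) := by
  have := h.isProbabilityMeasure
  have := Measure.isProbabilityMeasure_map (μ := P) (measurable_count hA).aemeasurable
  refine eq_extPoisson fun k => ?_
  rw [Measure.map_apply (measurable_count hA) (measurableSet_singleton _)]
  by_cases hμ : μ A = ⊤
  · rw [hμ, extPoisson_top]
    refine (h.count_eq_of_top A hA hμ k).trans ?_
    simp
  · rw [extPoisson_singleton hμ]
    exact h.count_eq A hA hμ k

theorem of_map_count
    (hi : ∀ (n : ℕ) (A : Fin n → Set X), (∀ i, MeasurableSet (A i)) →
      Pairwise (fun i j => Disjoint (A i) (A j)) → iIndepFun (fun i => count (A i)) P)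
    (h : ∀ A, MeasurableSet A → P.map (count A) = extPoisson (μ A)) : IsPoissonLaw μ P where
  indep := hi
  count_eq A hA hμ k := by
    rw [← extPoisson_singleton hμ, ← h A hA,
      Measure.map_apply (measurable_count hA) (measurableSet_singleton _)]
    rfl
  count_eq_of_top A hA hμ k := by
    have : {ω : CountableConfig X | ω.count A = k} = count A ⁻¹' {(k : ℕ∞)} := rfl
    rw [this, ← Measure.map_apply (measurable_count hA) (measurableSet_singleton _), h A hA, hμ,
      extPoisson_top]
    simp

theorem iIndepFun_count (h : IsPoissonLaw μ P) {ι : Type*} [Fintype ι] {A : ι → Set X}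
    (hA : ∀ i, MeasurableSet (A i)) (hd : Pairwise fun i j => Disjoint (A i) (A j)) :
    iIndepFun (fun i => count (A i)) P :=
  (h.indep _ (fun i => A ((Fintype.equivFin ι).symm i)) (fun _ => hA _)
    (fun _ _ hij => hd ((Fintype.equivFin ι).symm.injective.ne hij))).of_precomp
      (g := (Fintype.equivFin ι).symm) (Fintype.equivFin ι).symm.surjective

theorem measure_counts (h : IsPoissonLaw μ P) {ι : Type*} [Fintype ι] {A : ι → Set X}
    (hA : ∀ i, MeasurableSet (A i)) (hd : Pairwise fun i j => Disjoint (A i) (A j))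
    (k : ι → ℕ∞) :
    P {ω | ∀ i, count (A i) ω = k i} = ∏ i, extPoisson (μ (A i)) {k i} := by
  have h1 := (h.iIndepFun_count hA hd).meas_iInter
    (s := fun i => count (A i) ⁻¹' {k i}) fun i => ⟨{k i}, measurableSet_singleton _, rfl⟩
  convert h1 using 1
  · congr 1
    ext ω
    simp
  · refine Finset.prod_congr rfl fun i _ => ?_
    rw [← h.map_count (hA i), Measure.map_apply (measurable_count (hA i))
      (measurableSet_singleton _)]

theorem ext {Q : Measure (CountableConfig X)} (hP : IsPoissonLaw μ P) (hQ : IsPoissonLaw μ Q) :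
    P = Q := by
  have := hP.isProbabilityMeasure
  refine ext_of_counts fun ι _ l hl k => ?_
  have hd : Pairwise fun i j => Disjoint (l ⁻¹' {i}) (l ⁻¹' {j}) := fun i j hij =>
    Disjoint.preimage _ (by simpa using hij)
  have hset : (counts l ⁻¹' {k} : Set (CountableConfig X)) =
      {ω | ∀ i, count (l ⁻¹' {i}) ω = k i} := by
    ext ω
    simp [funext_iff, counts]
  rw [hset, hP.measure_counts hl hd, hQ.measure_counts hl hd]

end IsPoissonLaw

/-! ### Existence of the Poisson law for a non-atomic probability intensity -/

/-- Expand (∑ Xᵢ)^n once as a sum over words and once by the multinomial theorem, and compare the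
coefficients of the monomial with exponents `k`. -/
theorem card_filter_fiber_eq_multinomial {ι : Type*} [Fintype ι] [DecidableEq ι] (k : ι → ℕ) :
    (Finset.univ.filter fun c : Fin (∑ i, k i) → ι =>
      ∀ i, (Finset.univ.filter fun j => c j = i).card = k i).card =
      Nat.multinomial Finset.univ k := by
  classical
  set n := ∑ i, k i with hn
  have hm : ∀ m : ι → ℕ, (∏ i, (MvPolynomial.X i : MvPolynomial ι ℕ) ^ m i) =
      MvPolynomial.monomial (Finsupp.equivFunOnFinite.symm m) 1 := fun m => by
    rw [MvPolynomial.monomial_eq, Finsupp.prod_fintype _ _ fun i => pow_zero _]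
    simp
  have h1 : (∑ i, (MvPolynomial.X i : MvPolynomial ι ℕ)) ^ n =
      ∑ c : Fin n → ι, MvPolynomial.monomial (Finsupp.equivFunOnFinite.symm
        fun i => (Finset.univ.filter fun j => c j = i).card) 1 := by
    rw [Fintype.sum_pow]
    refine Finset.sum_congr rfl fun c _ => ?_
    rw [← hm, ← Finset.prod_fiberwise' Finset.univ c]
    simp
  have h2 : (∑ i, (MvPolynomial.X i : MvPolynomial ι ℕ)) ^ n =
      ∑ m ∈ Finset.piAntidiag Finset.univ n, (Nat.multinomial Finset.univ m : MvPolynomial ι ℕ) *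
        MvPolynomial.monomial (Finsupp.equivFunOnFinite.symm m) 1 := by
    rw [Finset.sum_pow_eq_sum_piAntidiag]
    exact Finset.sum_congr rfl fun m _ => by rw [hm]
  have h3 := congrArg (MvPolynomial.coeff (Finsupp.equivFunOnFinite.symm k)) (h1.symm.trans h2)
  rw [MvPolynomial.coeff_sum, MvPolynomial.coeff_sum] at h3
  simp only [← nsmul_eq_mul, MvPolynomial.coeff_smul, MvPolynomial.coeff_monomial,
    EmbeddingLike.apply_eq_iff_eq] at h3
  simp only [smul_eq_mul, mul_ite, mul_one, mul_zero] at h3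
  rw [Finset.sum_ite_eq' (Finset.piAntidiag Finset.univ n) k, if_pos (by simp [hn]),
    Finset.sum_boole] at h3
  simpa [funext_iff] using h3

namespace CountableConfig

variable {X : Type*}

/-- The set of values of a finite sequence. -/
def ofFin {n : ℕ} (x : Fin n → X) : CountableConfig X := ⟨range x, countable_range x⟩

open Classical in
-- Each value is counted at its first occurrence. The formula holds for sequences with repetitions
-- too, which gives measurability of `ofFin` everywhere.
theorem count_ofFin {n : ℕ} (B : Set X) (x : Fin n → X) :
    count B (ofFin x) = ∑ j, if x j ∈ B ∧ ∀ m < j, x m ≠ x j then 1 else 0 := by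
  have h : range x ∩ B =
      x '' (Finset.univ.filter fun j => x j ∈ B ∧ ∀ m < j, x m ≠ x j : Finset (Fin n)) := by
    ext y
    constructor
    · rintro ⟨⟨j, rfl⟩, hj⟩
      obtain ⟨m, hm, hmin⟩ := wellFounded_lt.has_min {m | x m = x j} ⟨j, rfl⟩
      have hm' : x m = x j := hm
      refine ⟨m, ?_, hm⟩
      simp only [Finset.coe_filter, Finset.mem_univ, true_and, mem_ofPred_eq, hm']
      exact ⟨hj, fun i hi h => hmin i h hi⟩
    · rintro ⟨j, hj, rfl⟩
      simp only [Finset.coe_filter, Finset.mem_univ, true_and, mem_ofPred_eq] at hj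
      exact ⟨⟨j, rfl⟩, hj.1⟩
  have hinj : InjOn x
      (Finset.univ.filter fun j => x j ∈ B ∧ ∀ m < j, x m ≠ x j : Finset (Fin n)) := by
    intro i hi j hj hij
    simp only [Finset.coe_filter, Finset.mem_univ, true_and, mem_ofPred_eq] at hi hj
    by_contra hne
    rcases lt_or_gt_of_ne hne with h | h
    · exact hj.2 i h hij
    · exact hi.2 j h hij.symm
  rw [count, ofFin, h, hinj.encard_image, encard_coe_eq_coe_finsetCard, Finset.sum_boole]

open Classical in
theorem count_ofFin_of_injective {n : ℕ} (B : Set X) {x : Fin n → X}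
    (hx : Function.Injective x) :
    count B (ofFin x) = ((Finset.univ.filter fun j => x j ∈ B).card : ℕ) := by
  rw [count_ofFin, Finset.sum_boole]
  congr 2
  ext j
  simp only [Finset.mem_filter, Finset.mem_univ, true_and, and_iff_left_iff_imp]
  exact fun _ m hm => hx.ne hm.ne

variable [MeasurableSpace X]

theorem measurable_ofFin [MeasurableEq X] {n : ℕ} :
    Measurable (ofFin : (Fin n → X) → CountableConfig X) := by
  classical
  refine measurable_of_count fun B hB => ?_
  simp only [count_ofFin]
  refine Finset.measurable_sum _ fun j _ => Measurable.ite ?_ measurable_const measurable_const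
  refine (measurable_pi_apply j hB).inter ?_
  have : {x : Fin n → X | ∀ m < j, x m ≠ x j} = ⋂ (m) (_ : m < j), {x | x m = x j}ᶜ := by
    ext
    simp
  change MeasurableSet {x : Fin n → X | ∀ m < j, x m ≠ x j}
  rw [this]
  exact .iInter fun m => .iInter fun _ =>
    (measurableSet_eq_fun (measurable_pi_apply m) (measurable_pi_apply j)).compl

end CountableConfig

section Finite

variable {X : Type*} [MeasurableSpace X]

/-- Two distinct coordinates have joint law ν × ν, for which the diagonal is null because ν has no
atoms. -/
theorem ae_pi_injective [MeasurableEq X] (ν : Measure X) [IsProbabilityMeasure ν]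
    [NullSingletonClass ν] (n : ℕ) :
    ∀ᵐ x ∂(Measure.pi fun _ : Fin n => ν), Function.Injective x := by
  have h : ∀ i j : Fin n, i ≠ j → ∀ᵐ x ∂(Measure.pi fun _ : Fin n => ν), x i ≠ x j := by
    intro i j hij
    have hind : IndepFun (fun x : Fin n → X => x i) (fun x => x j) (Measure.pi fun _ => ν) :=
      (iIndepFun_pi (X := fun _ (y : X) => y) (μ := fun _ : Fin n => ν)
        fun _ => aemeasurable_id).indepFun hij
    rw [indepFun_iff_map_prod_eq_prod_map_map (measurable_pi_apply i).aemeasurable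
        (measurable_pi_apply j).aemeasurable,
      (measurePreserving_eval (fun _ : Fin n => ν) i).map_eq,
      (measurePreserving_eval (fun _ : Fin n => ν) j).map_eq] at hind
    have hz : (ν.prod ν) (diagonal X) = 0 := by
      rw [Measure.prod_apply measurableSet_diagonal]
      have : ∀ x : X, Prod.mk x ⁻¹' diagonal X = {x} := fun x => by
        ext y
        simp [eq_comm]
      simp [this]
    rw [← hind, Measure.map_apply (by fun_prop) measurableSet_diagonal] at hz
    rw [ae_iff]
    convert hz using 2
    ext
    simp
  filter_upwards [ae_all_iff.2 fun i => ae_all_iff.2 fun j => ae_all_iff.2 (h i j)] with x hx i j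
  exact fun hij => by_contra fun hne => hx i j hne hij

/-- For an injective sequence the counts are the letter frequencies of the word of labels. Each word
with frequencies `k` has probability ∏ ν(fibre i)^{kᵢ}, and there are multinomially many. The
frequencies always add up to the length `n`. -/
theorem pi_measure_counts_ofFin [MeasurableEq X] (ν : Measure X) [IsProbabilityMeasure ν]
    [NullSingletonClass ν] {ι : Type*} [Fintype ι] {l : X → ι} (hl : ∀ i, MeasurableSet (l ⁻¹' {i}))
    (k : ι → ℕ) (n : ℕ) :
    (Measure.pi fun _ : Fin n => ν) {x | counts l (ofFin x) = fun i => (k i : ℕ∞)} =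
      if n = ∑ i, k i then Nat.multinomial Finset.univ k * ∏ i, ν (l ⁻¹' {i}) ^ k i else 0 := by
  classical
  have h0 : ({x | counts l (ofFin x) = fun i => (k i : ℕ∞)} : Set (Fin n → X)) =ᵐ[
      Measure.pi fun _ : Fin n => ν] {x | ∀ i, (Finset.univ.filter fun j => l (x j) = i).card = k i}
      := by
    filter_upwards [ae_pi_injective ν n] with x hx
    refine propext ?_
    change counts l (ofFin x) = _ ↔ ∀ i, _
    rw [funext_iff]
    refine forall_congr' fun i => ?_
    rw [counts, count_ofFin_of_injective _ hx, Nat.cast_inj]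
    simp
  rw [measure_congr h0]
  split_ifs with hn
  · subst hn
    have h1 : {x : Fin (∑ i, k i) → X | ∀ i, (Finset.univ.filter fun j => l (x j) = i).card = k i} =
        ⋃ c ∈ (Finset.univ.filter fun c : Fin (∑ i, k i) → ι =>
          ∀ i, (Finset.univ.filter fun j => c j = i).card = k i),
          univ.pi fun j => l ⁻¹' {c j} := by
      ext x
      simp only [mem_ofPred_eq, Finset.mem_filter, Finset.mem_univ, true_and, mem_iUnion, mem_pi,
        mem_univ, forall_const, mem_preimage, mem_singleton_iff, exists_prop]
      constructor
      · exact fun h => ⟨fun j => l (x j), h, fun j => rfl⟩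
      · rintro ⟨c, hc, hx⟩
        simpa only [hx] using hc
    rw [h1, measure_biUnion_finset]
    · rw [← card_filter_fiber_eq_multinomial k, ← nsmul_eq_mul, ← Finset.sum_const]
      refine Finset.sum_congr rfl fun c hc => ?_
      rw [Measure.pi_pi, ← Finset.prod_fiberwise' Finset.univ c fun i => ν (l ⁻¹' {i})]
      refine Finset.prod_congr rfl fun i _ => ?_
      rw [Finset.prod_const, (Finset.mem_filter.1 hc).2 i]
    · intro c _ c' _ hne
      refine disjoint_left.2 fun x hx hx' => hne (funext fun j => ?_)
      exact (hx j (mem_univ j)).symm.trans (hx' j (mem_univ j))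
    · exact fun c _ => .univ_pi fun j => hl _
  · convert measure_empty (μ := Measure.pi fun _ : Fin n => ν)
    refine eq_empty_of_forall_notMem fun x hx => hn ?_
    have : ∑ i, (Finset.univ.filter fun j => l (x j) = i).card = n := by
      rw [← Finset.card_eq_sum_card_fiberwise (f := fun j => l (x j)) (s := Finset.univ)
        fun _ _ => Finset.mem_coe.2 (Finset.mem_univ _)]
      simp
    rw [← this]
    exact Finset.sum_congr rfl fun i _ => hx i

/-- The mixture, over a Poisson distributed number `n`, of the laws of the sets of values of `n`
independent points with law `ν`. -/
noncomputable def poissonMixture (ν : Measure X) : Measure (CountableConfig X) :=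
  Measure.sum fun n : ℕ => ENNReal.ofReal (Real.exp (-1) / (n.factorial : ℝ)) •
    (Measure.pi fun _ : Fin n => ν).map ofFin

/-- Only n = ∑ kᵢ contributes. Its term e^{-1}/n! times the multinomial probability factorises into
Poisson weights, because the fibre masses add up to one. An infinite count has probability zero on
both sides. -/
theorem measure_counts_poissonMixture [MeasurableEq X] (ν : Measure X) [IsProbabilityMeasure ν]
    [NullSingletonClass ν] {ι : Type*} [Fintype ι] {l : X → ι} (hl : ∀ i, MeasurableSet (l ⁻¹' {i}))
    (k : ι → ℕ∞) :
    poissonMixture ν (counts l ⁻¹' {k}) = ∏ i, extPoisson (ν (l ⁻¹' {i})) {k i} := by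
  have hm : MeasurableSet (counts l ⁻¹' {k} : Set (CountableConfig X)) :=
    measurable_counts hl (measurableSet_singleton k)
  rw [poissonMixture, Measure.sum_apply _ hm]
  simp only [Measure.smul_apply, Measure.map_apply measurable_ofFin hm]
  by_cases hk : ∃ i, k i = ⊤
  · obtain ⟨i, hi⟩ := hk
    rw [Finset.prod_eq_zero (Finset.mem_univ i)
      (by rw [hi, extPoisson_singleton_top (measure_ne_top _ _)])]
    refine ENNReal.tsum_eq_zero.2 fun n => ?_
    have : (ofFin ⁻¹' (counts l ⁻¹' {k}) : Set (Fin n → X)) = ∅ := by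
      refine eq_empty_of_forall_notMem fun x hx => ?_
      have h1 : count (l ⁻¹' {i}) (ofFin x) = ⊤ := by
        rw [← hi, ← show counts l (ofFin x) = k from hx]
        rfl
      rw [count, encard_eq_top_iff] at h1
      exact h1 ((finite_range x).inter_of_left _)
    simp [this]
  · push Not at hk
    lift k to ι → ℕ using hk
    have hp : ∑ i, (ν (l ⁻¹' {i})).toReal = 1 := by
      rw [← ENNReal.toReal_sum fun i _ => measure_ne_top _ _, ← measure_biUnion_finset]
      · rw [← ENNReal.toReal_one, ← measure_univ (μ := ν)]
        congr 2
        ext x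
        simp
      · intro i _ j _ hij
        exact Disjoint.preimage _ (by simpa using hij)
      · exact fun i _ => hl i
    have hs : ∀ n, (Measure.pi fun _ : Fin n => ν) (ofFin ⁻¹' (counts l ⁻¹' {fun i => (k i : ℕ∞)}))
        = _ := fun n => pi_measure_counts_ofFin ν hl k n
    simp only [hs, smul_eq_mul, mul_ite, mul_zero]
    rw [tsum_ite_eq]
    simp only [extPoisson_singleton (measure_ne_top ν _)]
    rw [← ENNReal.ofReal_prod_of_nonneg fun i _ => by positivity, Finset.prod_div_distrib,
      Finset.prod_mul_distrib, ← Real.exp_sum, Finset.sum_neg_distrib, hp]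
    have h2 : ∏ i, ν (l ⁻¹' {i}) ^ k i =
        ENNReal.ofReal (∏ i, (ν (l ⁻¹' {i})).toReal ^ k i) := by
      rw [ENNReal.ofReal_prod_of_nonneg fun i _ => by positivity]
      refine Finset.prod_congr rfl fun i _ => ?_
      rw [ENNReal.ofReal_pow ENNReal.toReal_nonneg, ENNReal.ofReal_toReal (measure_ne_top _ _)]
    rw [h2, ← ENNReal.ofReal_natCast, ← ENNReal.ofReal_mul (by positivity),
      ← ENNReal.ofReal_mul (by positivity), ← Nat.multinomial_spec]
    congr 1
    have h3 : ∏ i, ((k i).factorial : ℝ) ≠ 0 :=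
      Finset.prod_ne_zero_iff.2 fun i _ => by positivity
    have h4 : (Nat.multinomial Finset.univ k : ℝ) ≠ 0 := by
      exact_mod_cast (Nat.multinomial_pos _ _).ne'
    push_cast
    field_simp

end Finite

namespace IsPoissonLaw

variable {X : Type*} [MeasurableSpace X]

theorem of_measure_counts {μ : Measure X} {P : Measure (CountableConfig X)}
    [IsFiniteMeasure P]
    (h : ∀ (ι : Type) [Fintype ι] (l : X → ι), (∀ i, MeasurableSet (l ⁻¹' {i})) → ∀ k : ι → ℕ∞,
      P (counts l ⁻¹' {k}) = ∏ i, extPoisson (μ (l ⁻¹' {i})) {k i}) : IsPoissonLaw μ P := by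
  have hmap : ∀ (ι : Type) [Fintype ι] (l : X → ι), (∀ i, MeasurableSet (l ⁻¹' {i})) →
      P.map (counts l) = Measure.pi fun i => extPoisson (μ (l ⁻¹' {i})) := by
    intro ι _ l hl
    refine Measure.ext_of_singleton fun k => ?_
    rw [Measure.map_apply (measurable_counts hl) (measurableSet_singleton k), h ι l hl,
      Measure.pi_singleton]
  have hP : IsProbabilityMeasure P := by
    constructor
    have h1 := congrArg (fun Q => Q univ) (hmap Unit (fun _ => ()) fun i => by simp)
    simpa [Measure.map_apply (measurable_counts (l := fun _ : X => ()) fun i => by simp)] using h1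
  have hc : ∀ (ι : Type) [Fintype ι] (l : X → ι), (∀ i, MeasurableSet (l ⁻¹' {i})) → ∀ i,
      P.map (count (l ⁻¹' {i})) = extPoisson (μ (l ⁻¹' {i})) := by
    intro ι _ l hl i
    have h1 : count (l ⁻¹' {i}) = Function.eval i ∘ (counts l : CountableConfig X → _) := rfl
    rw [h1, ← Measure.map_map (measurable_pi_apply i) (measurable_counts hl), hmap ι l hl,
      (measurePreserving_eval _ i).map_eq]
  refine of_map_count (fun n A hA hd => ?_) fun A hA => ?_
  · classical
    -- The label `none` collects the complement of the union, so that the disjoint family becomes a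
    -- partition; its count is discarded at the end by `precomp`.
    let l : X → Option (Fin n) := fun x => if h : ∃ i, x ∈ A i then some h.choose else none
    have hsome : ∀ i, l ⁻¹' {some i} = A i := by
      intro i
      ext x
      simp only [mem_preimage, mem_singleton_iff, l]
      constructor
      · intro hx
        split_ifs at hx with hex
        rw [← Option.some.inj hx]
        exact hex.choose_spec
      · intro hx
        have hex : ∃ i, x ∈ A i := ⟨i, hx⟩
        rw [dif_pos hex]
        by_contra hne
        exact disjoint_left.1 (hd fun he => hne (congrArg some he)) hex.choose_spec hx
    have hnone : l ⁻¹' {none} = (⋃ i, A i)ᶜ := by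
      ext x
      simp [l]
    have hl : ∀ i, MeasurableSet (l ⁻¹' {i}) := by
      rintro (_ | i)
      · rw [hnone]
        exact (MeasurableSet.iUnion hA).compl
      · rw [hsome]
        exact hA i
    have hi : iIndepFun (fun i => count (l ⁻¹' {i})) P := by
      rw [iIndepFun_iff_map_fun_eq_pi_map fun i => (measurable_count (hl i)).aemeasurable]
      simp only [hc _ l hl]
      exact hmap _ l hl
    have := hi.precomp (Option.some_injective (Fin n))
    simpa only [Function.comp_def, hsome] using this
  · have hA' : (fun x => x ∈ A) ⁻¹' {True} = A := by
      ext x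
      simp
    rw [← hA']
    exact hc Prop (fun x => x ∈ A) (fun i => (measurable_mem.2 hA) (measurableSet_singleton i)) True

end IsPoissonLaw

theorem isPoissonLaw_poissonMixture {X : Type*} [MeasurableSpace X] [MeasurableEq X]
    (ν : Measure X) [IsProbabilityMeasure ν] [NullSingletonClass ν] :
    IsPoissonLaw ν (poissonMixture ν) := by
  have : IsFiniteMeasure (poissonMixture ν) := by
    constructor
    have h1 := hasSum_one_poissonMeasure 1
    rw [poissonMixture, Measure.sum_apply _ .univ]
    simp only [Measure.smul_apply, Measure.map_apply measurable_ofFin .univ, preimage_univ,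
      measure_univ, smul_eq_mul, mul_one]
    simp only [NNReal.coe_one, one_pow, mul_one] at h1
    rw [← ENNReal.ofReal_tsum_of_nonneg (fun n => by positivity) h1.summable]
    exact ENNReal.ofReal_lt_top
  exact .of_measure_counts fun ι _ l hl k => measure_counts_poissonMixture ν hl k

/-! ### Superposition of independent Poisson processes on disjoint cells -/

instance : BorelSpace ℕ∞ where
  measurable_eq := le_antisymm
    (fun s _ => by
      let _ : MeasurableSpace ℕ∞ := borel ℕ∞
      have : BorelSpace ℕ∞ := ⟨rfl⟩
      exact s.to_countable.measurableSet) le_top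

theorem extPoisson_conv {a b : ℝ≥0∞} (ha : a ≠ ⊤) (hb : b ≠ ⊤) :
    (extPoisson a).conv (extPoisson b) = extPoisson (a + b) := by
  rw [extPoisson_of_ne_top ha, extPoisson_of_ne_top hb,
    extPoisson_of_ne_top (ENNReal.add_ne_top.2 ⟨ha, hb⟩), map_cast_poissonMeasure_conv,
    ENNReal.toNNReal_add ha hb]

-- The limit a = ∞ is included: m^k e^{-m} → 0 then matches the point mass at ∞.
open Filter Topology in
theorem tendsto_extPoisson_singleton {m : ℕ → ℝ≥0∞} {a : ℝ≥0∞} (hm : ∀ J, m J ≠ ⊤)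
    (h : Tendsto m atTop (𝓝 a)) (k : ℕ) :
    Tendsto (fun J => extPoisson (m J) {(k : ℕ∞)}) atTop (𝓝 (extPoisson a {(k : ℕ∞)})) := by
  simp only [extPoisson_singleton (hm _)]
  by_cases ha : a = ⊤
  · subst ha
    have h0 : extPoisson ⊤ {(k : ℕ∞)} = ENNReal.ofReal 0 := by
      rw [extPoisson_top]
      simp
    rw [h0]
    refine ENNReal.tendsto_ofReal ?_
    have h1 : Tendsto (fun J => (m J).toReal) atTop atTop := by
      rw [tendsto_atTop]
      intro b
      filter_upwards [h.eventually (lt_mem_nhds (ENNReal.ofReal_lt_top (r := b)))] with J hJ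
      exact (ENNReal.ofReal_le_iff_le_toReal (hm J)).1 hJ.le
    have h2 := ((Real.tendsto_pow_mul_exp_neg_atTop_nhds_zero k).comp h1).div_const
      (k.factorial : ℝ)
    rw [zero_div] at h2
    refine h2.congr fun J => ?_
    simp only [Function.comp_apply]
    ring
  · rw [extPoisson_singleton ha]
    refine ENNReal.tendsto_ofReal ?_
    have h1 : Tendsto (fun J => (m J).toReal) atTop (𝓝 a.toReal) :=
      (ENNReal.tendsto_toReal ha).comp h
    exact (((Real.continuous_exp.tendsto _).comp h1.neg).mul (h1.pow k)).div_const _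

namespace CountableConfig

variable {X : Type*}

/-- Any finite set of points in the union already lies in a single `B J`. -/
theorem count_iUnion_of_monotone {B : ℕ → Set X} (hB : Monotone B) (ω : CountableConfig X) :
    count (⋃ J, B J) ω = ⨆ J, count (B J) ω := by
  refine le_antisymm (ENat.forall_natCast_le_iff_le.1 fun n hn => ?_)
    (iSup_le fun J => count_mono (subset_iUnion B J) ω)
  obtain ⟨t, ht, htn⟩ := exists_subset_encard_eq hn
  have hfin : t.Finite := by
    rw [← encard_ne_top_iff, htn]
    exact ENat.natCast_ne_top n
  have : ∀ᶠ J in Filter.atTop, ∀ x ∈ t, x ∈ B J := by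
    refine (Filter.eventually_all_finite hfin).2 fun x hx => ?_
    obtain ⟨J, hJ⟩ := mem_iUnion.1 (ht hx).2
    exact Filter.eventually_atTop.2 ⟨J, fun K hK => hB hK hJ⟩
  obtain ⟨J, hJ⟩ := this.exists
  rw [← htn]
  have hsub : t ⊆ ω.carrier ∩ B J := fun x hx => ⟨(ht hx).1, hJ x hx⟩
  exact (encard_le_encard hsub).trans (le_iSup (fun J => count (B J) ω) J)

/-- The union of the sets `ω j ∩ c j`. -/
def merge (c : ℕ → Set X) (ω : ℕ → CountableConfig X) : CountableConfig X :=
  ⟨⋃ j, (ω j).carrier ∩ c j, countable_iUnion fun j => (ω j).countable.mono inter_subset_left⟩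

/-- Inside `c j` the merged configuration is `ω j`. The total is written as a supremum of finite
sums because those are the sums whose laws are computed by convolution. -/
theorem count_merge {c : ℕ → Set X} (hc : Pairwise fun i j => Disjoint (c i) (c j))
    (ω : ℕ → CountableConfig X) (A : Set X) :
    count A (merge c ω) = ⨆ J, ∑ j ∈ Finset.range J, count (A ∩ c j) (ω j) := by
  have h1 : ∀ j, count (A ∩ c j) (merge c ω) = count (A ∩ c j) (ω j) := fun j => by
    have : (merge c ω).carrier ∩ (A ∩ c j) = (ω j).carrier ∩ (A ∩ c j) := by
      ext x
      constructor
      · rintro ⟨hx, hA, hxj⟩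
        obtain ⟨i, hi, hxi⟩ := mem_iUnion.1 hx
        obtain rfl : i = j := by_contra fun hne => disjoint_left.1 (hc hne) hxi hxj
        exact ⟨hi, hA, hxj⟩
      · rintro ⟨hx, hA, hxj⟩
        exact ⟨mem_iUnion.2 ⟨j, hx, hxj⟩, hA, hxj⟩
    rw [count, this, count]
  have h2 : ∀ J, count (A ∩ ⋃ j < J, c j) (merge c ω) =
      ∑ j ∈ Finset.range J, count (A ∩ c j) (ω j) := fun J => by
    induction J with
    | zero => simp [count_eq_zero]
    | succ J ih =>
      rw [biUnion_lt_succ, inter_union_distrib_left, count_union, ih, Finset.sum_range_succ, h1]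
      refine (Disjoint.inter_left' _ ?_).inter_right' _
      simp only [disjoint_iUnion_left]
      exact fun j hj => hc hj.ne
  have h3 : count A (merge c ω) = count (⋃ J, A ∩ ⋃ j < J, c j) (merge c ω) := by
    rw [count, count]
    congr 1
    ext x
    constructor
    · rintro ⟨hx, hA⟩
      obtain ⟨j, hj, hxj⟩ := mem_iUnion.1 hx
      exact ⟨hx, mem_iUnion.2 ⟨j + 1, hA, mem_biUnion (Nat.lt_succ_self j) hxj⟩⟩
    · rintro ⟨hx, hA⟩
      obtain ⟨J, hJ⟩ := mem_iUnion.1 hA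
      exact ⟨hx, hJ.1⟩
  rw [h3, count_iUnion_of_monotone]
  · simp only [h2]
  · exact fun J K hJK => inter_subset_inter_right _
      (biUnion_subset_biUnion_left fun j (hj : j < J) => hj.trans_le hJK)

end CountableConfig

theorem measurable_iSup_sum_range :
    Measurable fun w : ℕ → ℕ∞ => ⨆ J, ∑ j ∈ Finset.range J, w j :=
  Measurable.iSup fun _ => Finset.measurable_sum _ fun j _ => measurable_pi_apply j

section Superposition

variable {X : Type*} [MeasurableSpace X]

theorem measurable_merge {c : ℕ → Set X} (hcm : ∀ j, MeasurableSet (c j))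
    (hc : Pairwise fun i j => Disjoint (c i) (c j)) : Measurable (merge c) := by
  refine measurable_of_count fun B hB => ?_
  simp only [count_merge hc]
  exact measurable_iSup_sum_range.comp (measurable_pi_lambda _ fun j =>
    (measurable_count (hB.inter (hcm j))).comp (measurable_pi_apply j))

theorem iIndepFun_comp_eval {ι κ : Type*} [Fintype ι] {Ω : κ → Type*}
    {mΩ : ∀ j, MeasurableSpace (Ω j)} (P : ∀ j, Measure (Ω j)) [∀ j, IsProbabilityMeasure (P j)]
    {β : Type*} [MeasurableSpace β] (j : κ) {f : ι → Ω j → β} (hf : ∀ i, Measurable (f i))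
    (h : iIndepFun f (P j)) :
    iIndepFun (fun i (ω : ∀ j, Ω j) => f i (ω j)) (Measure.infinitePi P) := by
  have hmp := measurePreserving_eval_infinitePi P j
  have h1 : ∀ i, (Measure.infinitePi P).map (fun ω => f i (ω j)) = (P j).map (f i) := fun i => by
    rw [← hmp.map_eq, Measure.map_map (hf i) hmp.measurable]
    rfl
  have hm : ∀ i, Measurable fun ω : ∀ j, Ω j => f i (ω j) := fun i =>
    (hf i).comp (measurable_pi_apply j)
  rw [iIndepFun_iff_map_fun_eq_pi_map fun i => (hm i).aemeasurable]
  simp only [h1]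
  rw [← h.map_fun_eq_pi_map fun i => (hf i).aemeasurable, ← hmp.map_eq,
    Measure.map_map (measurable_pi_lambda _ hf) hmp.measurable]
  rfl

theorem iIndepFun_curry {Ω ι κ β : Type*} [MeasurableSpace Ω] [MeasurableSpace β]
    {Q : Measure Ω} [IsProbabilityMeasure Q] {W : ι × κ → Ω → β} (hW : ∀ p, Measurable (W p))
    (h : iIndepFun W Q) : iIndepFun (fun i ω j => W (i, j) ω) Q := by
  have : ∀ p, IsProbabilityMeasure (Q.map (W p)) := fun p =>
    Measure.isProbabilityMeasure_map (hW p).aemeasurable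
  rw [iIndepFun_iff_map_fun_eq_infinitePi_map fun i => measurable_pi_lambda _ fun j => hW (i, j)]
  have h1 : ∀ i, Q.map (fun ω j => W (i, j) ω) =
      Measure.infinitePi fun j => Q.map (W (i, j)) := fun i =>
    (h.precomp (Prod.mk_right_injective i)).map_fun_eq_infinitePi_map fun j => hW (i, j)
  simp only [h1]
  rw [← Measure.infinitePi_map_curry fun i j => Q.map (W (i, j)),
    ← h.map_fun_eq_infinitePi_map hW,
    Measure.map_map (MeasurableEquiv.measurable _) (measurable_pi_lambda _ hW)]
  rfl

/-- The counts in `A i ∩ c j` are independent over all pairs: across `j` by the product measure,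
within one `j` by the Poisson property. Regrouping them by `i`, the count in `A i` is a function of
the i-th row alone. -/
theorem iIndepFun_count_merge {c : ℕ → Set X} (hcm : ∀ j, MeasurableSet (c j))
    (hc : Pairwise fun i j => Disjoint (c i) (c j)) {ν : ℕ → Measure X}
    [∀ j, IsFiniteMeasure (ν j)]
    {P : ℕ → Measure (CountableConfig X)} [∀ j, IsProbabilityMeasure (P j)]
    (hP : ∀ j, IsPoissonLaw (ν j) (P j))
    {n : ℕ} {A : Fin n → Set X} (hA : ∀ i, MeasurableSet (A i))
    (hd : Pairwise fun i j => Disjoint (A i) (A j)) :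
    iIndepFun (fun i => count (A i)) ((Measure.infinitePi P).map (merge c)) := by
  have hmm := measurable_merge hcm hc
  have hmi : ∀ j i, Measurable (count (A i ∩ c j) : CountableConfig X → ℕ∞) := fun j i =>
    measurable_count ((hA i).inter (hcm j))
  have hmeas : ∀ j i, Measurable fun ω : ℕ → CountableConfig X => count (A i ∩ c j) (ω j) :=
    fun j i => (hmi j i).comp (measurable_pi_apply j)
  have h0 : ∀ j, iIndepFun (fun i (ω : ℕ → CountableConfig X) => count (A i ∩ c j) (ω j))
      (Measure.infinitePi P) := fun j =>
    iIndepFun_comp_eval P j (hmi j) ((hP j).iIndepFun_count (fun i => (hA i).inter (hcm j))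
      fun i i' hi => ((hd hi).inter_left _).inter_right _)
  have h0' : iIndepFun (fun j (ω : ℕ → CountableConfig X) (i : Fin n) =>
      count (A i ∩ c j) (ω j)) (Measure.infinitePi P) :=
    iIndepFun_infinitePi (P := P)
      (X := fun j (ω : CountableConfig X) (i : Fin n) => count (A i ∩ c j) ω)
      fun j => measurable_pi_lambda _ (hmi j)
  have h1 : iIndepFun (fun (p : ℕ × Fin n) (ω : ℕ → CountableConfig X) =>
      count (A p.2 ∩ c p.1) (ω p.1)) (Measure.infinitePi P) :=
    iIndepFun_uncurry' (X := fun j i (ω : ℕ → CountableConfig X) => count (A i ∩ c j) (ω j))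
      hmeas h0' h0
  have h1' : iIndepFun (fun (p : Fin n × ℕ) (ω : ℕ → CountableConfig X) =>
      count (A p.1 ∩ c p.2) (ω p.2)) (Measure.infinitePi P) := h1.precomp Prod.swap_injective
  have h2 : iIndepFun (fun (i : Fin n) (ω : ℕ → CountableConfig X) (j : ℕ) =>
      count (A i ∩ c j) (ω j)) (Measure.infinitePi P) :=
    iIndepFun_curry (W := fun (p : Fin n × ℕ) (ω : ℕ → CountableConfig X) =>
      count (A p.1 ∩ c p.2) (ω p.2)) (fun p => hmeas p.2 p.1) h1'
  have h3 : iIndepFun (fun i ω => count (A i) (merge c ω)) (Measure.infinitePi P) := by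
    simp only [count_merge hc]
    exact h2.comp (fun _ w => ⨆ J, ∑ j ∈ Finset.range J, w j) fun _ => measurable_iSup_sum_range
  have hm3 : ∀ i, Measurable fun ω => count (A i) (merge c ω) := fun i =>
    (measurable_count (hA i)).comp hmm
  rw [iIndepFun_iff_map_fun_eq_pi_map fun i => (hm3 i).aemeasurable] at h3
  have := Measure.isProbabilityMeasure_map (μ := Measure.infinitePi P) hmm.aemeasurable
  rw [iIndepFun_iff_map_fun_eq_pi_map fun i => (measurable_count (hA i)).aemeasurable,
    Measure.map_map (measurable_pi_lambda _ fun i => measurable_count (hA i)) hmm]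
  simp only [Measure.map_map (measurable_count (hA _)) hmm]
  exact h3

-- The partial sums are Poisson by convolution and increase to the total count. Convergence of the
-- probabilities of each finite value then identifies the limit law.
open Filter Topology in
theorem map_count_merge {c : ℕ → Set X} (hcm : ∀ j, MeasurableSet (c j))
    (hc : Pairwise fun i j => Disjoint (c i) (c j)) {ν : ℕ → Measure X}
    [∀ j, IsFiniteMeasure (ν j)] (hν : ∀ j, ν j (c j)ᶜ = 0)
    {P : ℕ → Measure (CountableConfig X)} [∀ j, IsProbabilityMeasure (P j)]
    (hP : ∀ j, IsPoissonLaw (ν j) (P j))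
    {A : Set X} (hA : MeasurableSet A) :
    ((Measure.infinitePi P).map (merge c)).map (count A) = extPoisson (Measure.sum ν A) := by
  have hmm := measurable_merge hcm hc
  have hmeas : ∀ j, Measurable fun ω : ℕ → CountableConfig X => count (A ∩ c j) (ω j) := fun j =>
    (measurable_count (hA.inter (hcm j))).comp (measurable_pi_apply j)
  rw [Measure.map_map (measurable_count hA) hmm]
  have := Measure.isProbabilityMeasure_map (μ := Measure.infinitePi P)
    ((measurable_count hA).comp hmm).aemeasurable
  have hW : iIndepFun (fun j (ω : ℕ → CountableConfig X) => count (A ∩ c j) (ω j))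
      (Measure.infinitePi P) :=
    iIndepFun_infinitePi (P := P) fun j => measurable_count (hA.inter (hcm j))
  have hWlaw : ∀ j, (Measure.infinitePi P).map (fun ω => count (A ∩ c j) (ω j)) =
      extPoisson (ν j A) := fun j => by
    have hmp := measurePreserving_eval_infinitePi P j
    -- The measure `ν j` is carried by `c j`.
    have h0 : ν j (A ∩ c j) = ν j A := by
      have hz : ν j (A \ c j) = 0 := measure_mono_null (fun x hx => hx.2) (hν j)
      rw [← measure_inter_add_sdiff (μ := ν j) A (hcm j), hz, add_zero]
    rw [← h0, ← (hP j).map_count (hA.inter (hcm j)), ← hmp.map_eq,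
      Measure.map_map (measurable_count (hA.inter (hcm j))) hmp.measurable]
    rfl
  have hfin : ∀ J, ∑ j ∈ Finset.range J, ν j A ≠ ⊤ := fun J =>
    ENNReal.sum_ne_top.2 fun j _ => measure_ne_top _ _
  have hmS : ∀ J, Measurable
      (∑ j ∈ Finset.range J, fun ω : ℕ → CountableConfig X => count (A ∩ c j) (ω j)) :=
    fun J => by
      rw [Finset.sum_fn]
      exact Finset.measurable_sum _ fun j _ => hmeas j
  have hS : ∀ J, (Measure.infinitePi P).map
      (∑ j ∈ Finset.range J, fun ω : ℕ → CountableConfig X => count (A ∩ c j) (ω j)) =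
      extPoisson (∑ j ∈ Finset.range J, ν j A) := fun J => by
    induction J with
    | zero =>
      simp only [Finset.range_zero, Finset.sum_empty]
      have h0 : extPoisson 0 = Measure.dirac 0 := by
        refine (eq_extPoisson fun k => ?_).symm
        rw [extPoisson_singleton ENNReal.zero_ne_top]
        rcases k with _ | k <;> simp
      rw [h0]
      have h1 := Measure.map_const (Measure.infinitePi P) (0 : ℕ∞)
      rwa [measure_univ, one_smul] at h1
    | succ J ih =>
      rw [Finset.sum_range_succ, Finset.sum_range_succ, (hW.indepFun_sum_range_succ
        (fun j => hmeas j) J).map_add_eq_map_conv_map (hmS J) (hmeas J), ih,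
        hWlaw, extPoisson_conv (hfin J) (measure_ne_top _ _)]
  refine eq_extPoisson fun k => ?_
  have hlim : Tendsto (fun J => extPoisson (∑ j ∈ Finset.range J, ν j A) {(k : ℕ∞)}) atTop
      (𝓝 (extPoisson (Measure.sum ν A) {(k : ℕ∞)})) := by
    refine tendsto_extPoisson_singleton hfin ?_ k
    rw [Measure.sum_apply _ hA]
    exact ENNReal.tendsto_nat_tsum _
  refine tendsto_nhds_unique ?_ hlim
  simp only [← hS, Measure.map_apply (hmS _) (measurableSet_singleton _),
    Measure.map_apply ((measurable_count hA).comp hmm) (measurableSet_singleton _)]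
  refine tendsto_measure_of_tendsto_indicator_of_isFiniteMeasure atTop _
    (fun J => hmS J (measurableSet_singleton _)) fun ω => ?_
  have hmono : Monotone fun J => ∑ j ∈ Finset.range J, count (A ∩ c j) (ω j) :=
    fun J K hJK => Finset.sum_le_sum_of_subset (Finset.range_mono hJK)
  have ht := tendsto_atTop_iSup hmono
  rw [← count_merge hc] at ht
  simp only [mem_preimage, mem_singleton_iff, Finset.sum_apply, Function.comp_apply]
  by_cases hk : count A (merge c ω) = k
  -- Finite values are isolated in ℕ ∪ {∞}, so the partial sums are eventually equal to `k`.
  · rw [hk, ENat.nhds_natCast, tendsto_pure] at ht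
    filter_upwards [ht] with J hJ
    simp [hJ, hk]
  · filter_upwards [ht.eventually_ne hk] with J hJ
    simp [hJ, hk]

theorem isPoissonLaw_merge {c : ℕ → Set X} (hcm : ∀ j, MeasurableSet (c j))
    (hc : Pairwise fun i j => Disjoint (c i) (c j)) {ν : ℕ → Measure X}
    [∀ j, IsFiniteMeasure (ν j)] (hν : ∀ j, ν j (c j)ᶜ = 0)
    {P : ℕ → Measure (CountableConfig X)} [∀ j, IsProbabilityMeasure (P j)]
    (hP : ∀ j, IsPoissonLaw (ν j) (P j)) :
    IsPoissonLaw (Measure.sum ν) ((Measure.infinitePi P).map (merge c)) :=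
  .of_map_count (fun _ _ hA hd => iIndepFun_count_merge hcm hc hP hA hd)
    fun _ hA => map_count_merge hcm hc hν hP hA

end Superposition

/-! ### Lebesgue measure on the half-line, its meshes, and its Poisson law -/

section PosReal

theorem measurableEmbedding_posReal_val : MeasurableEmbedding (Subtype.val : PosReal → ℝ) :=
  .subtype_coe measurableSet_Ioi

theorem posLebesgue_preimage (S : Set ℝ) :
    posLebesgue (Subtype.val ⁻¹' S) = volume (S ∩ Ioi 0) := by
  rw [posLebesgue, measurableEmbedding_posReal_val.comap_apply, Subtype.image_preimage_coe,
    inter_comm]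

instance : NullSingletonClass posLebesgue where
  measure_singleton x := by
    rw [posLebesgue, measurableEmbedding_posReal_val.comap_apply, image_singleton]
    exact measure_singleton _

theorem posLebesgue_preimage_Ico {a b : ℝ} (ha : 0 ≤ a) :
    posLebesgue (Subtype.val ⁻¹' Ico a b) = ENNReal.ofReal (b - a) := by
  rw [posLebesgue_preimage]
  refine le_antisymm ?_ ?_
  · rw [← Real.volume_Ico]
    exact measure_mono inter_subset_left
  -- The open interval is used because for a = 0 the left endpoint is not a positive real.
  · rw [← Real.volume_Ioo]
    exact measure_mono fun x hx => ⟨⟨hx.1.le, hx.2⟩, ha.trans_lt hx.1⟩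

theorem posLebesgue_univ : posLebesgue univ = ⊤ := by
  rw [← preimage_univ, posLebesgue_preimage, univ_inter, Real.volume_Ioi]

/-- The index of the interval `[j / (n + 1), (j + 1) / (n + 1))` containing `x`. -/
noncomputable def cellIndex (n : ℕ) (x : PosReal) : ℕ := ⌊((n : ℝ) + 1) * (x : ℝ)⌋₊

theorem measurable_cellIndex (n : ℕ) : Measurable (cellIndex n) :=
  Nat.measurable_floor.comp (measurable_subtype_coe.const_mul _)

/-- The interval `[j / (n + 1), (j + 1) / (n + 1))` of positive reals. -/
def cell (n j : ℕ) : Set PosReal := cellIndex n ⁻¹' {j}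

theorem mem_cell {n j : ℕ} {x : PosReal} : x ∈ cell n j ↔ cellIndex n x = j := Iff.rfl

theorem measurableSet_cell (n j : ℕ) : MeasurableSet (cell n j) :=
  measurable_cellIndex n (measurableSet_singleton j)

theorem pairwise_disjoint_cell (n : ℕ) :
    Pairwise fun i j => Disjoint (cell n i) (cell n j) := fun _ _ hij =>
  Disjoint.preimage _ (by simpa using hij)

theorem iUnion_cell (n : ℕ) : ⋃ j, cell n j = univ := by
  ext x
  simp [mem_cell]

theorem cell_eq (n j : ℕ) : cell n j =
    Subtype.val ⁻¹' Ico ((j : ℝ) / ((n : ℝ) + 1)) (((j : ℝ) + 1) / ((n : ℝ) + 1)) := by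
  ext x
  have hn : (0 : ℝ) < (n : ℝ) + 1 := by positivity
  have hx : 0 ≤ ((n : ℝ) + 1) * (x : ℝ) := mul_nonneg hn.le x.2.le
  rw [mem_cell, cellIndex, Nat.floor_eq_iff hx, mem_preimage, mem_Ico, div_le_iff₀ hn,
    lt_div_iff₀ hn, mul_comm]

theorem posLebesgue_cell (n j : ℕ) :
    posLebesgue (cell n j) = ENNReal.ofReal (1 / ((n : ℝ) + 1)) := by
  rw [cell_eq, posLebesgue_preimage_Ico (by positivity)]
  congr 1
  ring

instance : SigmaFinite posLebesgue :=
  ⟨⟨⟨cell 0, fun _ => mem_univ _, fun j => by simp [posLebesgue_cell], iUnion_cell 0⟩⟩⟩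

theorem cellIndex_lt {n M : ℕ} {x : PosReal} (hx : (x : ℝ) < M) :
    cellIndex n x < M * (n + 1) := by
  have hn : (0 : ℝ) < (n : ℝ) + 1 := by positivity
  rw [cellIndex, Nat.floor_lt (mul_nonneg hn.le x.2.le)]
  push_cast
  rw [mul_comm]
  exact mul_lt_mul_of_pos_right hx hn

/-- Existence rules out the default value zero of `poissonLaw`. The cells of mesh 0 have length one,
so each restriction is a non-atomic probability measure; the mixtures on the cells are superposed.
-/
theorem isPoissonLaw_poissonLaw : IsPoissonLaw posLebesgue (poissonLaw posLebesgue) := by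
  have h : ∃ P, IsPoissonLaw posLebesgue P := by
    have hprob : ∀ j, IsProbabilityMeasure (posLebesgue.restrict (cell 0 j)) := fun j =>
      ⟨by rw [Measure.restrict_apply_univ, posLebesgue_cell]; simp⟩
    have hlaw : ∀ j, IsPoissonLaw (posLebesgue.restrict (cell 0 j))
        (poissonMixture (posLebesgue.restrict (cell 0 j))) := fun j =>
      isPoissonLaw_poissonMixture _
    have := fun j => (hlaw j).isProbabilityMeasure
    have hsum : Measure.sum (fun j => posLebesgue.restrict (cell 0 j)) = posLebesgue := by
      rw [← Measure.restrict_iUnion (pairwise_disjoint_cell 0) (measurableSet_cell 0),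
        iUnion_cell, Measure.restrict_univ]
    rw [← hsum]
    refine ⟨_, isPoissonLaw_merge (measurableSet_cell 0) (pairwise_disjoint_cell 0)
      (fun j => ?_) hlaw⟩
    rw [Measure.restrict_apply (measurableSet_cell 0 j).compl, compl_inter_self, measure_empty]
  rw [poissonLaw, dif_pos h]
  exact h.choose_spec

instance : IsProbabilityMeasure (poissonLaw posLebesgue) :=
  isPoissonLaw_poissonLaw.isProbabilityMeasure

end PosReal

/-! ### Regular configurations and the suspension -/

/-- From e^{-a} ≥ 1 - a one gets 1 - e^{-a}(1 + a) ≤ 1 - (1 - a)(1 + a) = a². -/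
theorem IsPoissonLaw.measure_one_lt_count_le {X : Type*} [MeasurableSpace X] {μ : Measure X}
    {P : Measure (CountableConfig X)} (h : IsPoissonLaw μ P) {A : Set X} (hA : MeasurableSet A)
    {a : ℝ} (ha : 0 ≤ a) (hμ : μ A = ENNReal.ofReal a) :
    P {ω | ¬ count A ω ≤ 1} ≤ ENNReal.ofReal (a ^ 2) := by
  have := h.isProbabilityMeasure
  have hm : MeasurableSet {ω : CountableConfig X | count A ω ≤ 1} :=
    measurable_count hA measurableSet_Iic
  have hc : {ω : CountableConfig X | ¬ count A ω ≤ 1} = {ω | count A ω ≤ 1}ᶜ := rfl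
  have hu : {ω : CountableConfig X | count A ω ≤ 1} =
      {ω | count A ω = (0 : ℕ)} ∪ {ω | count A ω = (1 : ℕ)} := by
    ext ω
    simp [Order.le_one_iff]
  have htop : μ A ≠ ⊤ := by simp [hμ]
  rw [hc, prob_compl_eq_one_sub hm, hu, measure_union _ (measurableSet_count_eq hA 1),
    h.count_eq A hA htop, h.count_eq A hA htop, hμ, ENNReal.toReal_ofReal ha,
    ← ENNReal.ofReal_add (by positivity) (by positivity), ← ENNReal.ofReal_one,
    ← ENNReal.ofReal_sub _ (by positivity)]
  · refine ENNReal.ofReal_le_ofReal ?_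
    have h1 := mul_le_mul_of_nonneg_right (Real.one_sub_le_exp_neg a) (by linarith : 0 ≤ 1 + a)
    norm_num
    nlinarith
  · refine disjoint_left.2 fun ω h0 h1 => ?_
    have h0 : count A ω = (0 : ℕ) := h0
    have h1 : count A ω = (1 : ℕ) := h1
    rw [h0] at h1
    exact absurd (ENat.natCast_inj.1 h1) (by norm_num)

/-- The configurations whose images under `f` have, in each bounded interval, at most one point,
with multiplicity, in each cell of some sufficiently fine mesh. -/
def separatedBy (f : PosReal → PosReal) : Set (CountableConfig PosReal) :=
  {ω | ∀ M : ℕ, ∃ n : ℕ, ∀ j < M * (n + 1), count (f ⁻¹' cell n j) ω ≤ 1}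

section separatedBy

variable {f g : PosReal → PosReal} {ω : CountableConfig PosReal}

theorem measurableSet_separatedBy (hf : Measurable f) : MeasurableSet (separatedBy f) := by
  have : separatedBy f = ⋂ M : ℕ, ⋃ n : ℕ, ⋂ j, ⋂ (_ : j < M * (n + 1)),
      {ω | count (f ⁻¹' cell n j) ω ≤ 1} := by
    ext ω
    simp [separatedBy]
  rw [this]
  exact .iInter fun M => .iUnion fun n => .iInter fun j => .iInter fun _ =>
    measurable_count (hf (measurableSet_cell n j)) measurableSet_Iic

/-- Points with a common image would be two points in the preimage of one cell. -/
theorem injOn_of_mem_separatedBy (h : ω ∈ separatedBy f) : InjOn f ω.carrier := by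
  intro x hx y hy hxy
  obtain ⟨M, hM⟩ := exists_nat_gt (f x : ℝ)
  obtain ⟨n, hn⟩ := h M
  exact count_le_one.1 (hn _ (cellIndex_lt hM)) x hx y hy rfl (by rw [mem_preimage, hxy]; rfl)

theorem finite_inter_lt_of_mem_separatedBy (h : ω ∈ separatedBy id) (M : ℕ) :
    (ω.carrier ∩ {x : PosReal | (x : ℝ) < M}).Finite := by
  obtain ⟨n, hn⟩ := h M
  have hsub : ω.carrier ∩ {x : PosReal | (x : ℝ) < M} ⊆
      ⋃ j ∈ Finset.range (M * (n + 1)), ω.carrier ∩ cell n j := fun x hx =>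
    mem_biUnion (Finset.mem_coe.2 (Finset.mem_range.2 (cellIndex_lt hx.2))) ⟨hx.1, rfl⟩
  refine Finite.subset (Finite.biUnion (Finset.finite_toSet _) fun j hj => ?_) hsub
  refine encard_ne_top_iff.1 (ne_top_of_le_ne_top ?_ (hn j (Finset.mem_range.1 hj)))
  exact ENat.natCast_ne_top 1

theorem separatedBy_mono {ω' : CountableConfig PosReal} (h : ω ∈ separatedBy f)
    (hω : ω'.carrier ⊆ ω.carrier) : ω' ∈ separatedBy f := fun M =>
  (h M).imp fun _ hn j hj =>
    (encard_le_encard (inter_subset_inter_left _ hω)).trans (hn j hj)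

/-- Injectivity is essential: otherwise the image set forgets multiplicities. -/
theorem CountableConfig.count_suspension {X : Type*} {T : X → X} {ω : CountableConfig X}
    (hT : InjOn T ω.carrier) (B : Set X) : count B (suspension T ω) = count (T ⁻¹' B) ω := by
  rw [count, suspension, ← image_inter_preimage, count,
    (hT.mono inter_subset_left).encard_image]

theorem suspension_mem_separatedBy (h : ω ∈ separatedBy (f ∘ g)) (hg : InjOn g ω.carrier) :
    suspension g ω ∈ separatedBy f := fun M =>
  (h M).imp fun n hn j hj => by
    rw [count_suspension hg]
    exact hn j hj

-- Union bound: M(n + 1) cells, whose preimages have measure 1/(n + 1), each contain two points with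
-- probability at most 1/(n + 1)². The total M/(n + 1) tends to 0.
open Filter Topology in
theorem ae_mem_separatedBy (hf : MeasurePreserving f posLebesgue posLebesgue) :
    ∀ᵐ ω ∂(poissonLaw posLebesgue), ω ∈ separatedBy f := by
  have key : ∀ M : ℕ, ∀ᵐ ω ∂(poissonLaw posLebesgue),
      ∃ n : ℕ, ∀ j < M * (n + 1), count (f ⁻¹' cell n j) ω ≤ 1 := by
    intro M
    have hb : ∀ n : ℕ, poissonLaw posLebesgue
        {ω | ¬ ∃ n : ℕ, ∀ j < M * (n + 1), count (f ⁻¹' cell n j) ω ≤ 1} ≤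
        ENNReal.ofReal (M * (1 / ((n : ℝ) + 1))) := by
      intro n
      calc poissonLaw posLebesgue
            {ω | ¬ ∃ n : ℕ, ∀ j < M * (n + 1), count (f ⁻¹' cell n j) ω ≤ 1}
          ≤ poissonLaw posLebesgue
            (⋃ j ∈ Finset.range (M * (n + 1)), {ω | ¬ count (f ⁻¹' cell n j) ω ≤ 1}) := by
            refine measure_mono fun ω hω => ?_
            simp only [mem_ofPred_eq, not_exists, not_forall] at hω
            obtain ⟨j, hj, hc⟩ := hω n
            exact mem_biUnion (Finset.mem_coe.2 (Finset.mem_range.2 hj)) hc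
        _ ≤ ∑ j ∈ Finset.range (M * (n + 1)), poissonLaw posLebesgue
            {ω | ¬ count (f ⁻¹' cell n j) ω ≤ 1} := measure_biUnion_finset_le _ _
        _ ≤ ∑ j ∈ Finset.range (M * (n + 1)), ENNReal.ofReal ((1 / ((n : ℝ) + 1)) ^ 2) :=
            Finset.sum_le_sum fun j _ => isPoissonLaw_poissonLaw.measure_one_lt_count_le
              (hf.measurable (measurableSet_cell n j)) (by positivity)
              (by rw [hf.measure_preimage (measurableSet_cell n j).nullMeasurableSet,
                posLebesgue_cell])
        _ = ENNReal.ofReal (M * (1 / ((n : ℝ) + 1))) := by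
            rw [Finset.sum_const, Finset.card_range, nsmul_eq_mul, ← ENNReal.ofReal_natCast,
              ← ENNReal.ofReal_mul (by positivity)]
            congr 1
            push_cast
            field_simp
    have hlim : Tendsto (fun n : ℕ => ENNReal.ofReal (M * (1 / ((n : ℝ) + 1)))) atTop (𝓝 0) := by
      rw [← ENNReal.ofReal_zero, ← mul_zero (M : ℝ)]
      exact ENNReal.tendsto_ofReal (tendsto_one_div_add_atTop_nhds_zero_nat.const_mul _)
    rw [ae_iff]
    exact le_antisymm (ge_of_tendsto' hlim hb) zero_le
  exact ae_all_iff.2 key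

end separatedBy

/-- The infinite configurations that are separated by all the iterates of `T`. -/
def regularConfigs (T : PosReal → PosReal) : Set (CountableConfig PosReal) :=
  {ω | count univ ω = ⊤} ∩ ⋂ k : ℕ, separatedBy T^[k]

section regularConfigs

variable {T : PosReal → PosReal} {ω : CountableConfig PosReal}

theorem measurableSet_regularConfigs (hT : Measurable T) : MeasurableSet (regularConfigs T) :=
  (measurable_count .univ (measurableSet_singleton ⊤)).inter
    (.iInter fun k => measurableSet_separatedBy (hT.iterate k))

theorem ae_mem_regularConfigs (hT : MeasurePreserving T posLebesgue posLebesgue) :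
    ∀ᵐ ω ∂(poissonLaw posLebesgue), ω ∈ regularConfigs T := by
  have h1 : ∀ᵐ ω ∂(poissonLaw posLebesgue), count univ ω = ⊤ := by
    have h := isPoissonLaw_poissonLaw.map_count .univ
    rw [posLebesgue_univ, extPoisson_top] at h
    have h2 : ∀ᵐ n ∂((poissonLaw posLebesgue).map (count univ)), n = ⊤ := by
      rw [h]
      simp
    exact ae_of_ae_map (measurable_count .univ).aemeasurable h2
  filter_upwards [h1, ae_all_iff.2 fun k => ae_mem_separatedBy (hT.iterate k)] with ω h h'
  exact ⟨h, mem_iInter.2 h'⟩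

theorem injOn_iterate (h : ω ∈ regularConfigs T) (k : ℕ) : InjOn T^[k] ω.carrier :=
  injOn_of_mem_separatedBy (mem_iInter.1 h.2 k)

theorem injOn_of_mem_regularConfigs (h : ω ∈ regularConfigs T) : InjOn T ω.carrier :=
  injOn_iterate h 1

/-- This is why all iterates enter the definition: separation of T_*ω by T^k is separation of ω by
T^{k+1}. -/
theorem suspension_mem_regularConfigs (h : ω ∈ regularConfigs T) :
    suspension T ω ∈ regularConfigs T := by
  refine ⟨?_, mem_iInter.2 fun k => ?_⟩
  · have : count univ (suspension T ω) = count (T ⁻¹' univ) ω :=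
      count_suspension (injOn_of_mem_regularConfigs h) univ
    rw [preimage_univ] at this
    exact this.trans h.1
  · exact suspension_mem_separatedBy (mem_iInter.1 h.2 (k + 1)) (injOn_of_mem_regularConfigs h)

theorem finite_inter_lt (h : ω ∈ regularConfigs T) (M : ℕ) :
    (ω.carrier ∩ {x : PosReal | (x : ℝ) < M}).Finite :=
  finite_inter_lt_of_mem_separatedBy (mem_iInter.1 h.2 0) M

open Classical in
/-- The suspension of `T` on the regular configurations, extended by the identity. -/
noncomputable def regularSuspension (T : PosReal → PosReal) :
    CountableConfig PosReal → CountableConfig PosReal :=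
  (regularConfigs T).piecewise (suspension T) id

open Classical in
theorem regularSuspension_of_mem (h : ω ∈ regularConfigs T) :
    regularSuspension T ω = suspension T ω := piecewise_eq_of_mem _ _ _ h

theorem measurable_regularSuspension (hT : Measurable T) : Measurable (regularSuspension T) := by
  classical
  refine measurable_of_count fun B hB => ?_
  have : (fun ω => count B (regularSuspension T ω)) =
      (regularConfigs T).piecewise (count (T ⁻¹' B)) (count B) := by
    ext1 ω
    by_cases h : ω ∈ regularConfigs T
    · rw [regularSuspension_of_mem h, piecewise_eq_of_mem _ _ _ h,
        count_suspension (injOn_of_mem_regularConfigs h)]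
    · rw [regularSuspension, piecewise_eq_of_notMem _ _ _ h, piecewise_eq_of_notMem _ _ _ h, id]
  rw [this]
  exact (measurable_count (hT hB)).piecewise (measurableSet_regularConfigs hT) (measurable_count hB)

/-- Almost surely the counts of T_*ω for a labelling `l` are those of ω for `l ∘ T`, whose fibres
have the same measures. The image law is thus Poisson, and uniqueness applies. -/
theorem measurePreserving_regularSuspension (hT : MeasurePreserving T posLebesgue posLebesgue) :
    MeasurePreserving (regularSuspension T) (poissonLaw posLebesgue) (poissonLaw posLebesgue) := by
  have hm := measurable_regularSuspension hT.measurable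
  have := Measure.isProbabilityMeasure_map (μ := poissonLaw posLebesgue) hm.aemeasurable
  refine ⟨hm, IsPoissonLaw.ext (.of_measure_counts fun ι _ l hl k => ?_) isPoissonLaw_poissonLaw⟩
  have hl' : ∀ i, MeasurableSet ((l ∘ T) ⁻¹' {i}) := fun i => hT.measurable (hl i)
  have hd : Pairwise fun i j => Disjoint ((l ∘ T) ⁻¹' {i}) ((l ∘ T) ⁻¹' {j}) := fun i j hij =>
    Disjoint.preimage _ (by simpa using hij)
  have hae : (regularSuspension T ⁻¹' (counts l ⁻¹' {k}) : Set _) =ᵐ[poissonLaw posLebesgue]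
      {ω | ∀ i, count ((l ∘ T) ⁻¹' {i}) ω = k i} := by
    filter_upwards [ae_mem_regularConfigs hT] with ω hω
    refine propext ?_
    change counts l (regularSuspension T ω) = k ↔ ∀ i, _
    rw [regularSuspension_of_mem hω, funext_iff]
    refine forall_congr' fun i => ?_
    rw [counts, count_suspension (injOn_of_mem_regularConfigs hω)]
    rfl
  rw [Measure.map_apply hm (measurable_counts hl (measurableSet_singleton k)), measure_congr hae,
    isPoissonLaw_poissonLaw.measure_counts hl' hd]
  refine Finset.prod_congr rfl fun i _ => ?_
  rw [preimage_comp, hT.measure_preimage (hl i).nullMeasurableSet]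

end regularConfigs

/-! ### Return times, induced maps and conservativity -/

section firstReturnTime

theorem iInf_natCast_eq_coe_iff {p : ℕ → Prop} {k : ℕ} :
    ⨅ (n : ℕ) (_ : p n), (n : ℕ∞) = k ↔ p k ∧ ∀ j < k, ¬ p j := by
  classical
  constructor
  · intro h
    have hex : ∃ n, p n := by
      by_contra hne
      push Not at hne
      have : ⨅ (n : ℕ) (_ : p n), (n : ℕ∞) = ⊤ := by
        simp only [iInf_eq_top]
        exact fun n hn => absurd hn (hne n)
      rw [this] at h
      exact ENat.top_ne_natCast k h
    have hle : (k : ℕ∞) ≤ Nat.find hex := h ▸ iInf₂_le (Nat.find hex) (Nat.find_spec hex)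
    have hge : ((Nat.find hex : ℕ) : ℕ∞) ≤ k := by
      rw [← h]
      exact le_iInf₂ fun n hn => by exact_mod_cast Nat.find_min' hex hn
    have hk : k = Nat.find hex := by exact_mod_cast le_antisymm hle hge
    rw [hk]
    exact ⟨Nat.find_spec hex, fun j => Nat.find_min hex⟩
  · rintro ⟨hk, hlt⟩
    exact le_antisymm (iInf₂_le k hk) (le_iInf₂ fun n hn => by
      by_contra hcon
      exact hlt n (by exact_mod_cast not_le.1 hcon) hn)

variable {Y : Type*} {S : Y → Y} {D : Set Y} {y : Y}

theorem firstReturnTime_eq_coe_iff {k : ℕ} : firstReturnTime S D y = k ↔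
    (1 ≤ k ∧ S^[k] y ∈ D) ∧ ∀ j < k, ¬ (1 ≤ j ∧ S^[j] y ∈ D) :=
  iInf_natCast_eq_coe_iff

theorem firstReturnTime_lt_top_iff :
    firstReturnTime S D y < ⊤ ↔ ∃ n, 1 ≤ n ∧ S^[n] y ∈ D := by
  simp only [firstReturnTime, iInf_lt_top, ENat.natCast_lt_top, exists_prop, and_true]

/-- The map `y ↦ S^{φ(y)}(y)`, where `φ` is the first return time to `D`. -/
noncomputable def returnMap (S : Y → Y) (D : Set Y) (y : Y) : Y :=
  S^[(firstReturnTime S D y).toNat] y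

theorem exists_returnMap_eq (h : firstReturnTime S D y < ⊤) :
    ∃ k, 1 ≤ k ∧ firstReturnTime S D y = (k : ℕ) ∧ returnMap S D y = S^[k] y := by
  obtain ⟨k, hk⟩ := ENat.ne_top_iff_exists.1 h.ne
  exact ⟨k, (firstReturnTime_eq_coe_iff.1 hk.symm).1.1, hk.symm, by
    rw [returnMap, ← hk, ENat.toNat_natCast]⟩

theorem frequently_iterate_mem_iterate (h : ∃ᶠ n in Filter.atTop, S^[n] y ∈ D) (K : ℕ) :
    ∃ᶠ n in Filter.atTop, S^[n] (S^[K] y) ∈ D := by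
  rw [Filter.frequently_atTop] at h ⊢
  intro a
  obtain ⟨b, hb, hD⟩ := h (a + K)
  refine ⟨b - K, by omega, ?_⟩
  rwa [← Function.iterate_add_apply, Nat.sub_add_cancel (by omega)]

theorem firstReturnTime_lt_top_of_frequently (h : ∃ᶠ n in Filter.atTop, S^[n] y ∈ D) :
    firstReturnTime S D y < ⊤ := by
  obtain ⟨b, hb, hD⟩ := Filter.frequently_atTop.1 h 1
  exact firstReturnTime_lt_top_iff.2 ⟨b, hb, hD⟩

/-- Each return takes at least one step, so k returns take at least k steps. -/
theorem exists_iterate_returnMap_eq (h : ∃ᶠ n in Filter.atTop, S^[n] y ∈ D) (k : ℕ) :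
    ∃ K, k ≤ K ∧ (returnMap S D)^[k] y = S^[K] y := by
  induction k with
  | zero => exact ⟨0, le_rfl, rfl⟩
  | succ k ih =>
    obtain ⟨K, hK, hKy⟩ := ih
    obtain ⟨j, hj, -, hjy⟩ := exists_returnMap_eq
      (firstReturnTime_lt_top_of_frequently (frequently_iterate_mem_iterate h K))
    refine ⟨j + K, by omega, ?_⟩
    rw [Function.iterate_succ_apply', hKy, hjy, Function.iterate_add_apply]

variable [MeasurableSpace Y]

theorem measurable_firstReturnTime (hS : Measurable S) (hD : MeasurableSet D) :
    Measurable (firstReturnTime S D) := by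
  classical
  unfold firstReturnTime
  refine Measurable.iInf fun n => ?_
  simp only [iInf_eq_if]
  exact Measurable.ite ((MeasurableSet.const _).inter (hS.iterate n hD))
    measurable_const measurable_const

theorem measurable_returnMap (hS : Measurable S) (hD : MeasurableSet D) :
    Measurable (returnMap S D) := by
  have h1 : Measurable fun p : ℕ × Y => S^[p.1] p.2 :=
    measurable_from_prod_countable_right fun n => hS.iterate n
  have h2 : Measurable fun y => (firstReturnTime S D y).toNat :=
    (measurable_from_top (f := ENat.toNat)).comp (measurable_firstReturnTime hS hD)
  exact h1.comp (h2.prodMk measurable_id)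

variable {m : Measure Y}

/-- Let `V n` consist of the points that first enter `D` at time n, at a point of `B`. Its preimage
under `S` splits into the points of `D` returning at time n + 1 in `B`, which form `E n`, and the
points outside `D`, which form `V (n + 1)`. By invariance the masses telescope from `V 0 = B`. -/
theorem measure_inter_preimage_returnMap_le (hS : MeasurePreserving S m m)
    (hD : MeasurableSet D) {B : Set Y} (hB : MeasurableSet B) (hBD : B ⊆ D) :
    m {y | y ∈ D ∧ firstReturnTime S D y < ⊤ ∧ returnMap S D y ∈ B} ≤ m B := by
  let V : ℕ → Set Y := fun n => {y | S^[n] y ∈ B ∧ ∀ j < n, S^[j] y ∉ D}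
  let E : ℕ → Set Y := fun n =>
    {y | y ∈ D ∧ firstReturnTime S D y = (n + 1 : ℕ) ∧ S^[n + 1] y ∈ B}
  have hV : ∀ n, MeasurableSet (V n) := fun n => by
    have : V n = S^[n] ⁻¹' B ∩ ⋂ (j) (_ : j < n), (S^[j] ⁻¹' D)ᶜ := by
      ext
      simp [V]
    rw [this]
    exact (hS.measurable.iterate n hB).inter
      (.iInter fun j => .iInter fun _ => (hS.measurable.iterate j hD).compl)
  have hstep : ∀ n, m (V n) = m (E n) + m (V (n + 1)) := fun n => by
    rw [← hS.measure_preimage (hV n).nullMeasurableSet,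
      ← measure_inter_add_sdiff (S ⁻¹' V n) hD]
    congr 2
    · ext y
      simp only [V, E, mem_inter_iff, mem_preimage, mem_ofPred_eq, firstReturnTime_eq_coe_iff]
      constructor
      · rintro ⟨⟨h1, h2⟩, h3⟩
        refine ⟨h3, ⟨⟨by omega, hBD h1⟩, fun j hj hjD => ?_⟩, h1⟩
        obtain ⟨i, rfl⟩ := Nat.exists_eq_add_of_le' hjD.1
        exact h2 i (by omega) hjD.2
      · rintro ⟨h1, ⟨h2, h3⟩, h4⟩
        exact ⟨⟨h4, fun j hj hjD => h3 (j + 1) (by omega) ⟨by omega, hjD⟩⟩, h1⟩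
    · ext y
      simp only [V, mem_sdiff, mem_preimage, mem_ofPred_eq]
      constructor
      · rintro ⟨⟨h1, h2⟩, h3⟩
        refine ⟨h1, fun j hj => ?_⟩
        rcases j with _ | j
        · exact h3
        · exact h2 j (by omega)
      · rintro ⟨h1, h2⟩
        exact ⟨⟨h1, fun j hj => h2 (j + 1) (by omega)⟩, h2 0 (by omega)⟩
  have hsum : ∀ N, ∑ n ∈ Finset.range N, m (E n) + m (V N) = m B := fun N => by
    induction N with
    | zero => simp [V]
    | succ N ih => rw [Finset.sum_range_succ, add_assoc, ← hstep, ih]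
  calc m {y | y ∈ D ∧ firstReturnTime S D y < ⊤ ∧ returnMap S D y ∈ B}
      ≤ m (⋃ n, E n) := by
        refine measure_mono fun y hy => ?_
        obtain ⟨k, hk, hφ, hr⟩ := exists_returnMap_eq hy.2.1
        refine mem_iUnion.2 ⟨k - 1, hy.1, ?_, ?_⟩
        · rw [Nat.sub_add_cancel hk, hφ]
        · rw [Nat.sub_add_cancel hk, ← hr]
          exact hy.2.2
    _ ≤ ∑' n, m (E n) := measure_iUnion_le _
    _ ≤ m B := ENNReal.tsum_le_of_sum_range_le fun N => (hsum N) ▸ le_self_add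

/-- The image measure is at most the original one, and the two have the same finite total mass. -/
theorem measurePreserving_returnMap (hS : MeasurePreserving S m m) (hD : MeasurableSet D)
    (hfin : m D ≠ ⊤) (hret : ∀ᵐ y ∂m, y ∈ D → firstReturnTime S D y < ⊤) :
    MeasurePreserving (returnMap S D) (m.restrict D) (m.restrict D) := by
  have hm := measurable_returnMap hS.measurable hD
  have : IsFiniteMeasure (m.restrict D) := isFiniteMeasure_restrict.2 hfin
  refine ⟨hm, Measure.eq_of_le_of_measure_univ_eq ?_ ?_⟩
  · refine Measure.le_iff.2 fun E hE => ?_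
    rw [Measure.map_apply hm hE, Measure.restrict_apply (hm hE), Measure.restrict_apply hE]
    refine (measure_mono_ae ?_).trans
      (measure_inter_preimage_returnMap_le hS hD (hE.inter hD) inter_subset_right)
    filter_upwards [hret] with y hy hyE
    have hφ := hy hyE.2
    obtain ⟨k, -, hk, hr⟩ := exists_returnMap_eq hφ
    refine ⟨hyE.2, hφ, hyE.1, ?_⟩
    rw [hr]
    exact (firstReturnTime_eq_coe_iff.1 hk).1.2
  · rw [Measure.map_apply hm .univ, preimage_univ]

end firstReturnTime

/-- A set of positive measure meets some D = F × Z with F of finite measure. Conservativity of `T`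
makes almost every point of `D` return to it infinitely often, so the induced map on `D` preserves a
finite measure and Poincaré recurrence applies. Its returns are returns of the product map. -/
theorem MeasureTheory.Conservative.prodMap {X Z : Type*} [MeasurableSpace X] [MeasurableSpace Z]
    {μ : Measure X} [SigmaFinite μ] {P : Measure Z} [IsFiniteMeasure P] {T : X → X} {R : Z → Z}
    (hc : Conservative T μ) (hT : MeasurePreserving T μ μ) (hR : MeasurePreserving R P P) :
    Conservative (Prod.map T R) (μ.prod P) := by
  have hS : MeasurePreserving (Prod.map T R) (μ.prod P) (μ.prod P) := hT.prod hR
  refine ⟨hS.quasiMeasurePreserving, fun s hs hs0 => ?_⟩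
  obtain ⟨M, hM⟩ : ∃ M, (μ.prod P) (s ∩ spanningSets μ M ×ˢ univ) ≠ 0 := by
    by_contra! hne
    refine hs0 (measure_mono_null ?_ (measure_iUnion_null hne))
    rw [← inter_iUnion, ← iUnion_prod_const, iUnion_spanningSets, univ_prod_univ, inter_univ]
  set D : Set (X × Z) := spanningSets μ M ×ˢ univ
  have hDm : MeasurableSet D := (measurableSet_spanningSets μ M).prod .univ
  have hfin : (μ.prod P) D ≠ ⊤ := by
    rw [Measure.prod_prod]
    exact ENNReal.mul_ne_top (measure_spanningSets_lt_top μ M).ne (measure_ne_top _ _)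
  have hfreq : ∀ᵐ y ∂(μ.prod P), y ∈ D → ∃ᶠ n in Filter.atTop, (Prod.map T R)^[n] y ∈ D := by
    filter_upwards [Measure.quasiMeasurePreserving_fst.ae
      (hc.ae_mem_imp_frequently_image_mem (measurableSet_spanningSets μ M).nullMeasurableSet)]
      with y hy hyD
    refine (hy hyD.1).mono fun n hn => ⟨?_, mem_univ _⟩
    rwa [Prod.map_iterate]
  have : IsFiniteMeasure ((μ.prod P).restrict D) := isFiniteMeasure_restrict.2 hfin
  have hcons := (measurePreserving_returnMap hS hDm hfin (by
    filter_upwards [hfreq] with y hy hyD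
    exact firstReturnTime_lt_top_of_frequently (hy hyD))).conservative
  -- Points with only finitely many returns are removed, since `returnMap` is the identity where the
  -- return time is infinite and its iterates would not give positive times.
  have hae : (s ∩ D : Set (X × Z)) =ᵐ[(μ.prod P).restrict D]
      {y | y ∈ s ∧ y ∈ D ∧ ∃ᶠ n in Filter.atTop, (Prod.map T R)^[n] y ∈ D} := by
    filter_upwards [ae_restrict_of_ae hfreq] with y hy
    refine propext ⟨fun h => ⟨h.1, h.2, hy h.2⟩, fun h => ⟨h.1, h.2.1⟩⟩
  obtain ⟨x, hx, k, hk, hkx⟩ := hcons.exists_mem_iterate_mem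
    ((hs.inter hDm).nullMeasurableSet.congr hae) (by
      rw [← measure_congr hae, Measure.restrict_apply (hs.inter hDm), inter_assoc, inter_self]
      exact hM)
  obtain ⟨K, hK, hKx⟩ := exists_iterate_returnMap_eq hx.2.2 k
  exact ⟨x, hx.1, K, by omega, hKx ▸ hkx.1⟩

/-! ### Splitting off the leftmost point -/

theorem leftmostPoint_eq_of_isLeast {ω : CountableConfig PosReal} {x : PosReal}
    (h : IsLeast ω.carrier x) : leftmostPoint ω = x := by
  have h1 : IsLeast ((Subtype.val : PosReal → ℝ) '' ω.carrier) x :=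
    ⟨mem_image_of_mem _ h.1, by
      rintro _ ⟨y, hy, rfl⟩
      exact h.2 hy⟩
  have h2 : sInf ((Subtype.val : PosReal → ℝ) '' ω.carrier) = x := h1.csInf_eq
  rw [leftmostPoint, dif_pos (h2.symm ▸ x.2)]
  exact Subtype.ext h2

/-- The configuration `ω` without its leftmost point. -/
def eraseLeftmost (ω : CountableConfig PosReal) : CountableConfig PosReal :=
  ⟨ω.carrier \ {leftmostPoint ω}, ω.countable.mono sdiff_subset⟩

theorem count_eq_eraseLeftmost_add {ω : CountableConfig PosReal}
    (h : leftmostPoint ω ∈ ω.carrier) (B : Set PosReal) [Decidable (leftmostPoint ω ∈ B)] :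
    count B ω = count B (eraseLeftmost ω) + if leftmostPoint ω ∈ B then 1 else 0 := by
  have h1 : ω.carrier ∩ B =
      ((eraseLeftmost ω).carrier ∩ B) ∪ ({leftmostPoint ω} ∩ B) := by
    rw [← union_inter_distrib_right, eraseLeftmost, sdiff_union_self,
      union_eq_self_of_subset_right (singleton_subset_iff.2 h)]
  have hd : Disjoint ((eraseLeftmost ω).carrier ∩ B) ({leftmostPoint ω} ∩ B) :=
    (disjoint_sdiff_left.inter_left _).inter_right _
  rw [count, h1, encard_union_eq hd, count]
  congr 1
  split_ifs with hB
  · rw [inter_eq_self_of_subset_left (singleton_subset_iff.2 hB), encard_singleton]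
  · rw [singleton_inter_eq_empty.2 hB, encard_empty]

section regularConfigs

variable {T : PosReal → PosReal} {ω : CountableConfig PosReal}

/-- A regular configuration is nonempty and has finitely many points below any bound. -/
theorem isLeast_leftmostPoint (h : ω ∈ regularConfigs T) :
    IsLeast ω.carrier (leftmostPoint ω) := by
  have hne : ω.carrier.Nonempty := by
    by_contra hne
    have h1 : count univ ω = ⊤ := h.1
    rw [count, not_nonempty_iff_eq_empty.1 hne] at h1
    simp at h1
  obtain ⟨y, hy⟩ := hne
  obtain ⟨M, hM⟩ := exists_nat_gt (y : ℝ)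
  obtain ⟨x, hx⟩ := (finite_inter_lt h M).exists_minimal ⟨y, hy, hM⟩
  have hle : IsLeast ω.carrier x := by
    refine ⟨hx.1.1, fun z hz => ?_⟩
    by_contra hzx
    have hzx : z < x := not_le.1 hzx
    have hzM : (z : ℝ) < M := lt_trans hzx hx.1.2
    exact absurd (hx.2 ⟨hz, hzM⟩ hzx.le) (not_le.2 hzx)
  rwa [leftmostPoint_eq_of_isLeast hle]

theorem mem_regularConfigs_of_count {ω' : CountableConfig PosReal} (h : ω ∈ regularConfigs T)
    (hω : ω'.carrier ⊆ ω.carrier) (hc : count univ ω' = ⊤) : ω' ∈ regularConfigs T :=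
  ⟨hc, mem_iInter.2 fun k => separatedBy_mono (mem_iInter.1 h.2 k) hω⟩

theorem eraseLeftmost_mem_regularConfigs (h : ω ∈ regularConfigs T) :
    eraseLeftmost ω ∈ regularConfigs T := by
  classical
  refine mem_regularConfigs_of_count h sdiff_subset ?_
  have h1 := count_eq_eraseLeftmost_add (isLeast_leftmostPoint h).1 univ
  have h2 : count univ ω = ⊤ := h.1
  rw [h2, if_pos (mem_univ _)] at h1
  by_contra hne
  exact WithTop.add_ne_top.2 ⟨hne, ENat.one_ne_top⟩ h1.symm

theorem leftmostPoint_lt_eraseLeftmost (h : ω ∈ regularConfigs T) :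
    leftmostPoint ω < leftmostPoint (eraseLeftmost ω) := by
  have h1 := (isLeast_leftmostPoint (eraseLeftmost_mem_regularConfigs h)).1
  exact lt_of_le_of_ne ((isLeast_leftmostPoint h).2 h1.1) fun he => h1.2 he.symm

open Classical in
/-- The leftmost point on the regular configurations, extended by `1`. -/
noncomputable def regularLeftmost (T : PosReal → PosReal) : CountableConfig PosReal → PosReal :=
  (regularConfigs T).piecewise leftmostPoint fun _ => ⟨1, mem_Ioi.2 one_pos⟩

open Classical in
theorem regularLeftmost_of_mem (h : ω ∈ regularConfigs T) :
    regularLeftmost T ω = leftmostPoint ω := piecewise_eq_of_mem _ _ _ h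

theorem measurable_regularLeftmost (hT : Measurable T) : Measurable (regularLeftmost T) := by
  classical
  refine measurable_of_Iic fun a => ?_
  have h1 : regularLeftmost T ⁻¹' Iic a =
      (regularConfigs T ∩ {ω | count (Iic a) ω = 0}ᶜ) ∪
      ((regularConfigs T)ᶜ ∩ {_ω | (⟨1, mem_Ioi.2 one_pos⟩ : PosReal) ≤ a}) := by
    ext ω
    by_cases h : ω ∈ regularConfigs T
    · have hl := isLeast_leftmostPoint h
      simp only [mem_preimage, regularLeftmost_of_mem h, mem_Iic, mem_union, mem_inter_iff, h,
        true_and, mem_compl_iff, mem_ofPred_eq, not_true, false_and, or_false, count_eq_zero,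
        not_forall, not_not]
      exact ⟨fun hle => ⟨_, hl.1, hle⟩, fun ⟨x, hx, hxa⟩ => (hl.2 hx).trans hxa⟩
    · rw [mem_preimage, regularLeftmost, piecewise_eq_of_notMem _ _ _ h]
      simp [h]
  rw [h1]
  exact ((measurableSet_regularConfigs hT).inter
    (measurable_count measurableSet_Iic (measurableSet_singleton 0)).compl).union
    ((measurableSet_regularConfigs hT).compl.inter (.const _))

open Classical in
/-- The map `ω ↦ (t₁(ω), ω \ {t₁(ω)})`, with an arbitrary value off the regular configurations. -/
noncomputable def splitLeftmost (T : PosReal → PosReal) (ω : CountableConfig PosReal) :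
    PosReal × CountableConfig PosReal :=
  (regularLeftmost T ω, (regularConfigs T).piecewise eraseLeftmost id ω)

open Classical in
theorem splitLeftmost_of_mem (h : ω ∈ regularConfigs T) :
    splitLeftmost T ω = (leftmostPoint ω, eraseLeftmost ω) := by
  rw [splitLeftmost, regularLeftmost_of_mem h, piecewise_eq_of_mem _ _ _ h]

theorem measurable_splitLeftmost (hT : Measurable T) : Measurable (splitLeftmost T) := by
  classical
  refine (measurable_regularLeftmost hT).prodMk (measurable_of_count fun B hB => ?_)
  have h1 : (fun ω => count B ((regularConfigs T).piecewise eraseLeftmost id ω)) =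
      (regularConfigs T).piecewise
        (fun ω => count B ω - if regularLeftmost T ω ∈ B then 1 else 0) (count B) := by
    ext1 ω
    by_cases h : ω ∈ regularConfigs T
    · rw [piecewise_eq_of_mem _ _ _ h, piecewise_eq_of_mem _ _ _ h, regularLeftmost_of_mem h,
        count_eq_eraseLeftmost_add (isLeast_leftmostPoint h).1 B]
      split_ifs
      -- Subtracting the finite value 1 undoes its addition even when the count is infinite.
      · exact ((ENat.addLECancellable_of_ne_top ENat.one_ne_top).add_tsub_cancel_right).symm
      · simp
    · rw [piecewise_eq_of_notMem _ _ _ h, piecewise_eq_of_notMem _ _ _ h, id]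
  rw [h1]
  refine Measurable.piecewise (measurableSet_regularConfigs hT) ?_ (measurable_count hB)
  have h2 : Measurable fun p : ℕ∞ × ℕ∞ => p.1 - p.2 := measurable_of_countable _
  exact h2.comp ((measurable_count hB).prodMk (Measurable.ite
    (measurable_regularLeftmost hT hB) measurable_const measurable_const))

/-- The pairs `(x, ω)`, `ω` regular, such that `x` is to the left of all the points of `ω`. -/
def regularLeftmostSet (T : PosReal → PosReal) : Set (PosReal × CountableConfig PosReal) :=
  {p | p.2 ∈ regularConfigs T ∧ p.1 < leftmostPoint p.2}

theorem measurableSet_regularLeftmostSet (hT : Measurable T) :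
    MeasurableSet (regularLeftmostSet T) := by
  have : regularLeftmostSet T = Prod.snd ⁻¹' regularConfigs T ∩
      {p | p.1 < regularLeftmost T p.2} := by
    ext p
    refine and_congr_right fun h => ?_
    rw [mem_ofPred_eq, regularLeftmost_of_mem h]
  rw [this]
  exact (measurable_snd (measurableSet_regularConfigs hT)).inter
    (measurableSet_lt measurable_fst ((measurable_regularLeftmost hT).comp measurable_snd))

/-- This lets X₀ be replaced, up to a null set, by the measurable set `regularLeftmostSet T`. -/
theorem mem_leftmostSet_iff (p : PosReal × CountableConfig PosReal)
    (h : p.2 ∈ regularConfigs T) : p ∈ leftmostSet ↔ p.1 < leftmostPoint p.2 := by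
  have hl := isLeast_leftmostPoint h
  change p.2.carrier ∩ Iic p.1 = ∅ ↔ _
  rw [eq_empty_iff_forall_notMem]
  constructor
  · intro h1
    by_contra hle
    exact h1 _ ⟨hl.1, not_lt.1 hle⟩
  · rintro h1 y ⟨hy, hyx⟩
    exact absurd ((hl.2 hy).trans hyx) (not_le.2 h1)

theorem mem_regularLeftmostSet_iff (p : PosReal × CountableConfig PosReal) :
    p ∈ regularLeftmostSet T ↔ p.2 ∈ regularConfigs T ∧ p ∈ leftmostSet :=
  and_congr_right fun h => (mem_leftmostSet_iff p h).symm

theorem posLebesgue_Iic (x : PosReal) : posLebesgue (Iic x) = ENNReal.ofReal x := by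
  have : (Iic x : Set PosReal) = Subtype.val ⁻¹' Iic (x : ℝ) := rfl
  rw [this, posLebesgue_preimage, inter_comm, Ioi_inter_Iic, Real.volume_Ioc, sub_zero]

/-- The section at x has the probability e^{-x} that no point lies in (0, x], and these integrate to
one. -/
theorem productMeasure_regularLeftmostSet (hT : MeasurePreserving T posLebesgue posLebesgue) :
    productMeasure (regularLeftmostSet T) = 1 := by
  have h1 : ∀ x : PosReal, poissonLaw posLebesgue (Prod.mk x ⁻¹' regularLeftmostSet T) =
      ENNReal.ofReal (Real.exp (-(x : ℝ))) := fun x => by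
    have hae : (Prod.mk x ⁻¹' regularLeftmostSet T : Set _) =ᵐ[poissonLaw posLebesgue]
        {ω | count (Iic x) ω = (0 : ℕ)} := by
      filter_upwards [ae_mem_regularConfigs hT] with ω hω
      refine propext ?_
      change (ω ∈ regularConfigs T ∧ x < leftmostPoint ω) ↔ count (Iic x) ω = (0 : ℕ)
      have hl := isLeast_leftmostPoint hω
      rw [Nat.cast_zero, count_eq_zero]
      exact ⟨fun h y hy hyx => absurd ((hl.2 hy).trans hyx) (not_le.2 h.2),
        fun h => ⟨hω, not_le.1 fun hle => h _ hl.1 hle⟩⟩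
    rw [measure_congr hae, isPoissonLaw_poissonLaw.count_eq _ measurableSet_Iic
      (by simp [posLebesgue_Iic]), posLebesgue_Iic, ENNReal.toReal_ofReal x.2.le]
    simp
  rw [productMeasure, Measure.prod_apply (measurableSet_regularLeftmostSet hT.measurable)]
  simp only [h1]
  rw [posLebesgue, lintegral_subtype_comap measurableSet_Ioi
    fun x : ℝ => ENNReal.ofReal (Real.exp (-x)),
    ← ofReal_integral_eq_lintegral_ofReal, integral_exp_neg_Ioi_zero, ENNReal.ofReal_one]
  · have h2 : IntegrableOn (fun x : ℝ => Real.exp (-x)) (Ioi 0) := by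
      simpa using exp_neg_integrableOn_Ioi 0 one_pos
    exact h2
  · exact ae_of_all _ fun x => (Real.exp_pos _).le

end regularConfigs

/-! ### The law of the leftmost point together with the rest, by mesh approximation -/

theorem extPoisson_singleton_one {a : ℝ≥0∞} (ha : a ≠ ⊤) :
    extPoisson a {1} = a * extPoisson a {0} := by
  have h0 := extPoisson_singleton ha 0
  have h1 := extPoisson_singleton ha 1
  rw [Nat.cast_zero] at h0
  rw [Nat.cast_one] at h1
  rw [h0, h1]
  nth_rw 3 [← ENNReal.ofReal_toReal ha]
  rw [← ENNReal.ofReal_mul ENNReal.toReal_nonneg]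
  congr 1
  simp
  ring

/-- The event that `ω` has no point to the left of the cell of index `j`, has `e` points in this
cell, all of them in `s`, and has, to the right of this cell, `k i` points with label `i`. -/
def meshEvent {ι : Type} (l : PosReal → ι) (s : Set PosReal) (k : ι → ℕ∞) (n j : ℕ) (e : ℕ∞) :
    Set (CountableConfig PosReal) :=
  {ω | count (cellIndex n ⁻¹' Iio j) ω = 0 ∧ count (cell n j ∩ s) ω = e ∧
    count (cell n j \ s) ω = 0 ∧ ∀ i, count (l ⁻¹' {i} ∩ cellIndex n ⁻¹' Ioi j) ω = k i}

theorem pairwise_disjoint_meshEvent {ι : Type} (l : PosReal → ι) (s : Set PosReal)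
    (k : ι → ℕ∞) (n : ℕ) :
    Pairwise fun i j => Disjoint (meshEvent l s k n i 1) (meshEvent l s k n j 1) := by
  have key : ∀ i j, i < j → Disjoint (meshEvent l s k n i 1) (meshEvent l s k n j 1) := by
    intro i j hij
    refine disjoint_left.2 fun ω h1 h2 => ?_
    have h3 : count (cell n i ∩ s) ω ≠ 0 := by
      rw [h1.2.1]
      exact one_ne_zero
    refine h3 (count_eq_zero.2 fun x hx hxi => count_eq_zero.1 h2.1 x hx ?_)
    rw [mem_preimage, mem_cell.1 hxi.1]
    exact hij
  intro i j hij
  rcases lt_or_gt_of_ne hij with h | h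
  · exact key i j h
  · exact (key j i h).symm

section mesh

variable {ι : Type} [Fintype ι] {l : PosReal → ι} {s : Set PosReal}

theorem measurableSet_meshEvent (hl : ∀ i, MeasurableSet (l ⁻¹' {i})) (hs : MeasurableSet s)
    (k : ι → ℕ∞) (n j : ℕ) (e : ℕ∞) : MeasurableSet (meshEvent l s k n j e) := by
  have hi := measurable_cellIndex n
  have h1 : meshEvent l s k n j e = count (cellIndex n ⁻¹' Iio j) ⁻¹' {0} ∩
      (count (cell n j ∩ s) ⁻¹' {e} ∩ (count (cell n j \ s) ⁻¹' {0} ∩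
        ⋂ i, count (l ⁻¹' {i} ∩ cellIndex n ⁻¹' Ioi j) ⁻¹' {k i})) := by
    ext ω
    simp [meshEvent]
  rw [h1]
  exact (measurable_count (hi measurableSet_Iio) (measurableSet_singleton _)).inter
    ((measurable_count ((measurableSet_cell n j).inter hs) (measurableSet_singleton _)).inter
      ((measurable_count ((measurableSet_cell n j).diff hs) (measurableSet_singleton _)).inter
        (.iInter fun i => measurable_count ((hl i).inter (hi measurableSet_Ioi))
          (measurableSet_singleton _))))

theorem measure_meshEvent (hl : ∀ i, MeasurableSet (l ⁻¹' {i})) (hs : MeasurableSet s)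
    (k : ι → ℕ∞) (n j : ℕ) (e : ℕ∞) : poissonLaw posLebesgue (meshEvent l s k n j e) =
      extPoisson (posLebesgue (cellIndex n ⁻¹' Iio j)) {0} *
      (extPoisson (posLebesgue (cell n j ∩ s)) {e} *
      (extPoisson (posLebesgue (cell n j \ s)) {0} *
      ∏ i, extPoisson (posLebesgue (l ⁻¹' {i} ∩ cellIndex n ⁻¹' Ioi j)) {k i})) := by
  classical
  have hi := measurable_cellIndex n
  -- The nested labels stand for: left of the cell, in the cell and in `s`, in the cell and off `s`,
  -- and right of the cell with the original label. Independence over this partition gives the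
  -- product.
  let L : PosReal → Option (Option (Option ι)) := fun x =>
    if cellIndex n x < j then none else if cellIndex n x = j then
      (if x ∈ s then some none else some (some none)) else some (some (some (l x)))
  have h0 : L ⁻¹' {none} = cellIndex n ⁻¹' Iio j := by
    ext x
    simp only [L, mem_preimage, mem_singleton_iff, mem_Iio]
    split_ifs <;> simp_all
  have h1 : L ⁻¹' {some none} = cell n j ∩ s := by
    ext x
    simp only [L, mem_preimage, mem_singleton_iff, mem_inter_iff, mem_cell]
    split_ifs <;> simp_all <;> omega
  have h2 : L ⁻¹' {some (some none)} = cell n j \ s := by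
    ext x
    simp only [L, mem_preimage, mem_singleton_iff, mem_sdiff, mem_cell]
    split_ifs <;> simp_all <;> omega
  have h3 : ∀ i, L ⁻¹' {some (some (some i))} = l ⁻¹' {i} ∩ cellIndex n ⁻¹' Ioi j := fun i => by
    ext x
    simp only [L, mem_preimage, mem_singleton_iff, mem_inter_iff, mem_Ioi]
    split_ifs <;> simp_all <;> omega
  have hL : ∀ o, MeasurableSet (L ⁻¹' {o}) := by
    rintro (_ | _ | _ | i)
    · exact h0 ▸ hi measurableSet_Iio
    · exact h1 ▸ (measurableSet_cell n j).inter hs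
    · exact h2 ▸ (measurableSet_cell n j).diff hs
    · exact h3 i ▸ (hl i).inter (hi measurableSet_Ioi)
  let K : Option (Option (Option ι)) → ℕ∞ := fun o =>
    o.elim 0 fun o => o.elim e fun o => o.elim 0 k
  have h := isPoissonLaw_poissonLaw.measure_counts hL
    (fun i j hij => Disjoint.preimage _ (by simpa using hij)) K
  simp only [Fintype.prod_option, Option.forall, h0, h1, h2, h3, K, Option.elim_none,
    Option.elim_some] at h
  exact h

theorem measure_meshEvent_one (hl : ∀ i, MeasurableSet (l ⁻¹' {i})) (hs : MeasurableSet s)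
    (k : ι → ℕ∞) (n j : ℕ) : poissonLaw posLebesgue (meshEvent l s k n j 1) =
      posLebesgue (cell n j ∩ s) * poissonLaw posLebesgue (meshEvent l s k n j 0) := by
  have hfin : posLebesgue (cell n j ∩ s) ≠ ⊤ :=
    ne_top_of_le_ne_top (by simp [posLebesgue_cell]) (measure_mono inter_subset_left)
  rw [measure_meshEvent hl hs, measure_meshEvent hl hs, extPoisson_singleton_one hfin]
  ring

/-- Discrete form of the isomorphism of measures, exact for every mesh: the only point in the first
occupied cell is exchanged for a Lebesgue point x of the cell, with no points of ω there. -/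
theorem measure_iUnion_meshEvent (hl : ∀ i, MeasurableSet (l ⁻¹' {i})) (hs : MeasurableSet s)
    (k : ι → ℕ∞) (n : ℕ) : poissonLaw posLebesgue (⋃ j, meshEvent l s k n j 1) =
      productMeasure (⋃ j, (cell n j ∩ s) ×ˢ meshEvent l s k n j 0) := by
  rw [measure_iUnion (pairwise_disjoint_meshEvent l s k n)
    fun j => measurableSet_meshEvent hl hs k n j 1, measure_iUnion]
  · refine tsum_congr fun j => ?_
    rw [measure_meshEvent_one hl hs, productMeasure, Measure.prod_prod]
  · intro i j hij
    exact Disjoint.set_prod_left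
      (((pairwise_disjoint_cell n hij).inter_left _).inter_right _) _ _
  · exact fun j => ((measurableSet_cell n j).inter hs).prod (measurableSet_meshEvent hl hs k n j 0)

end mesh

theorem cellIndex_mono (n : ℕ) : Monotone (cellIndex n) := fun x y hxy =>
  Nat.floor_mono (mul_le_mul_of_nonneg_left (show (x : ℝ) ≤ y from hxy) (by positivity))

theorem eventually_cellIndex_lt {x y : PosReal} (h : x < y) :
    ∀ᶠ n in Filter.atTop, cellIndex n x < cellIndex n y := by
  have hxy : (0 : ℝ) < (y : ℝ) - x := sub_pos.2 h
  obtain ⟨N, hN⟩ := exists_nat_gt (1 / ((y : ℝ) - x))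
  refine Filter.eventually_atTop.2 ⟨N, fun n hn => ?_⟩
  have h1 : 1 < (n : ℝ) * ((y : ℝ) - x) := by
    have h2 : (N : ℝ) ≤ n := by exact_mod_cast hn
    rw [div_lt_iff₀ hxy] at hN
    nlinarith
  have h3 : 0 ≤ ((n : ℝ) + 1) * (x : ℝ) := mul_nonneg (by positivity) x.2.le
  rw [cellIndex, cellIndex, ← Nat.add_one_le_iff, ← Nat.floor_add_one h3]
  exact Nat.floor_mono (by nlinarith)

section split

variable {T : PosReal → PosReal} {ω : CountableConfig PosReal} {ι : Type}
  {l : PosReal → ι} {s : Set PosReal} {k : ι → ℕ∞}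

/-- Once the mesh separates the two leftmost points, the cell of t₁ contains no other point and
everything else lies to its right. -/
theorem mem_iUnion_meshEvent_iff {n : ℕ} (h : ω ∈ regularConfigs T)
    (hn : cellIndex n (leftmostPoint ω) < cellIndex n (leftmostPoint (eraseLeftmost ω))) :
    ω ∈ ⋃ j, meshEvent l s k n j 1 ↔
      leftmostPoint ω ∈ s ∧ counts l (eraseLeftmost ω) = k := by
  have hl := isLeast_leftmostPoint h
  have hl' := isLeast_leftmostPoint (eraseLeftmost_mem_regularConfigs h)
  set t := leftmostPoint ω with ht
  have hlt : ∀ y ∈ ω.carrier, y ≠ t → cellIndex n t < cellIndex n y := fun y hy hyt =>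
    hn.trans_le (cellIndex_mono n (hl'.2 ⟨hy, hyt⟩))
  have hcounts : ∀ i, count (l ⁻¹' {i} ∩ cellIndex n ⁻¹' Ioi (cellIndex n t)) ω =
      counts l (eraseLeftmost ω) i := fun i => by
    rw [counts, count, count]
    congr 1
    ext y
    constructor
    · rintro ⟨hy, hyi, hyt⟩
      refine ⟨⟨hy, fun he => ?_⟩, hyi⟩
      have he : y = t := he
      have hyt : cellIndex n t < cellIndex n y := hyt
      rw [he] at hyt
      exact lt_irrefl _ hyt
    · rintro ⟨⟨hy, hyt⟩, hyi⟩
      exact ⟨hy, hyi, hlt y hy hyt⟩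
  rw [mem_iUnion]
  constructor
  · rintro ⟨j, h1, h2, h3, h4⟩
    have hne : count (cell n j ∩ s) ω ≠ 0 := by
      rw [h2]
      exact one_ne_zero
    rw [ne_eq, count_eq_zero] at hne
    push Not at hne
    obtain ⟨z, hz, hzj, -⟩ := hne
    have hj : cellIndex n t = j := by
      refine le_antisymm ?_ (not_lt.1 fun hlt => count_eq_zero.1 h1 t hl.1 hlt)
      rw [← mem_cell.1 hzj]
      exact cellIndex_mono n (hl.2 hz)
    subst hj
    refine ⟨by_contra fun hts => count_eq_zero.1 h3 t hl.1 ⟨rfl, hts⟩, funext fun i => ?_⟩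
    rw [← h4 i, hcounts]
  · rintro ⟨hts, rfl⟩
    refine ⟨cellIndex n t, ?_, ?_, ?_, hcounts⟩
    · exact count_eq_zero.2 fun y hy hyt => absurd (cellIndex_mono n (hl.2 hy)) (not_le.2 hyt)
    · rw [count, encard_eq_one]
      refine ⟨t, Subset.antisymm (fun y hy => ?_) (singleton_subset_iff.2 ⟨hl.1, rfl, hts⟩)⟩
      by_contra hyt
      exact (hlt y hy.1 hyt).ne' hy.2.1
    · refine count_eq_zero.2 fun y hy hyt => ?_
      by_cases hyt' : y = t
      · exact hyt.2 (hyt' ▸ hts)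
      · exact (hlt y hy hyt').ne' hyt.1

/-- All points of ω lie in later cells than x. Restricting the product measure to the leftmost pairs
therefore loses no mass of the mesh events. -/
theorem cellIndex_lt_of_mem_meshEvent {n j : ℕ} {x : PosReal} (h : ω ∈ regularConfigs T)
    (hx : x ∈ cell n j) (hω : ω ∈ meshEvent l s k n j 0) : x < leftmostPoint ω := by
  have hl := isLeast_leftmostPoint h
  by_contra hle
  have h1 := cellIndex_mono n (not_lt.1 hle)
  rw [mem_cell.1 hx] at h1
  rcases h1.lt_or_eq with h2 | h2
  · exact count_eq_zero.1 hω.1 _ hl.1 h2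
  · by_cases hs : leftmostPoint ω ∈ s
    · exact count_eq_zero.1 hω.2.1 _ hl.1 ⟨h2, hs⟩
    · exact count_eq_zero.1 hω.2.2.1 _ hl.1 ⟨h2, hs⟩

theorem mem_iUnion_prod_meshEvent_iff {n : ℕ} {x : PosReal} (h : ω ∈ regularConfigs T)
    (hn : cellIndex n x < cellIndex n (leftmostPoint ω)) :
    (x, ω) ∈ ⋃ j, (cell n j ∩ s) ×ˢ meshEvent l s k n j 0 ↔ x ∈ s ∧ counts l ω = k := by
  have hl := isLeast_leftmostPoint h
  have hlt : ∀ y ∈ ω.carrier, cellIndex n x < cellIndex n y := fun y hy =>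
    hn.trans_le (cellIndex_mono n (hl.2 hy))
  have hcounts : ∀ i, count (l ⁻¹' {i} ∩ cellIndex n ⁻¹' Ioi (cellIndex n x)) ω =
      counts l ω i := fun i => by
    rw [counts, count, count]
    congr 1
    ext y
    exact ⟨fun hy => ⟨hy.1, hy.2.1⟩, fun hy => ⟨hy.1, hy.2, hlt y hy.1⟩⟩
  rw [mem_iUnion]
  constructor
  · rintro ⟨j, ⟨hxj, hxs⟩, -, -, -, h4⟩
    have hxj : cellIndex n x = j := hxj
    subst hxj
    exact ⟨hxs, funext fun i => by rw [← h4 i, hcounts]⟩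
  · rintro ⟨hxs, rfl⟩
    refine ⟨cellIndex n x, ⟨rfl, hxs⟩, ?_, ?_, ?_, hcounts⟩
    · exact count_eq_zero.2 fun y hy hyt => lt_asymm (hlt y hy) hyt
    · exact count_eq_zero.2 fun y hy hyt => (hlt y hy).ne' hyt.1
    · exact count_eq_zero.2 fun y hy hyt => (hlt y hy).ne' hyt.1

-- The mesh events on the two sides have equal measure for every n, and their indicators converge
-- almost everywhere to those of the desired events. The restricted product measure is finite, so
-- both limits may be taken.
open Filter Topology in
theorem measure_split_counts [Fintype ι] (hT : MeasurePreserving T posLebesgue posLebesgue)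
    (hl : ∀ i, MeasurableSet (l ⁻¹' {i})) (hs : MeasurableSet s) (k : ι → ℕ∞) :
    (poissonLaw posLebesgue).map (splitLeftmost T) (s ×ˢ (counts l ⁻¹' {k})) =
      productMeasure.restrict (regularLeftmostSet T) (s ×ˢ (counts l ⁻¹' {k})) := by
  have hE : MeasurableSet (s ×ˢ (counts l ⁻¹' {k} : Set (CountableConfig PosReal))) :=
    hs.prod (measurable_counts hl (measurableSet_singleton k))
  have hD := measurableSet_regularLeftmostSet hT.measurable
  have hreg : ∀ᵐ p ∂productMeasure, p.2 ∈ regularConfigs T :=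
    Measure.quasiMeasurePreserving_snd.ae (ae_mem_regularConfigs hT)
  have : IsFiniteMeasure (productMeasure.restrict (regularLeftmostSet T)) :=
    isFiniteMeasure_restrict.2 (by simp [productMeasure_regularLeftmostSet hT])
  have h1 : Tendsto (fun n => poissonLaw posLebesgue (⋃ j, meshEvent l s k n j 1)) atTop
      (𝓝 ((poissonLaw posLebesgue).map (splitLeftmost T) (s ×ˢ (counts l ⁻¹' {k})))) := by
    rw [Measure.map_apply (measurable_splitLeftmost hT.measurable) hE]
    refine tendsto_measure_of_ae_tendsto_indicator_of_isFiniteMeasure atTop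
      (measurable_splitLeftmost hT.measurable hE)
      (fun n => .iUnion fun j => measurableSet_meshEvent hl hs k n j 1) ?_
    filter_upwards [ae_mem_regularConfigs hT] with ω hω
    filter_upwards [eventually_cellIndex_lt (leftmostPoint_lt_eraseLeftmost hω)] with n hn
    rw [mem_iUnion_meshEvent_iff hω hn, mem_preimage, splitLeftmost_of_mem hω]
    rfl
  have hmE : ∀ n, MeasurableSet (⋃ j, (cell n j ∩ s) ×ˢ meshEvent l s k n j 0) := fun n =>
    .iUnion fun j => ((measurableSet_cell n j).inter hs).prod
      (measurableSet_meshEvent hl hs k n j 0)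
  have h2 : Tendsto (fun n => productMeasure.restrict (regularLeftmostSet T)
      (⋃ j, (cell n j ∩ s) ×ˢ meshEvent l s k n j 0)) atTop
      (𝓝 (productMeasure.restrict (regularLeftmostSet T) (s ×ˢ (counts l ⁻¹' {k})))) := by
    refine tendsto_measure_of_ae_tendsto_indicator_of_isFiniteMeasure atTop hE hmE ?_
    filter_upwards [ae_restrict_mem hD] with p hp
    filter_upwards [eventually_cellIndex_lt hp.2] with n hn
    exact mem_iUnion_prod_meshEvent_iff hp.1 hn
  have h3 : ∀ n, productMeasure.restrict (regularLeftmostSet T)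
      (⋃ j, (cell n j ∩ s) ×ˢ meshEvent l s k n j 0) =
      poissonLaw posLebesgue (⋃ j, meshEvent l s k n j 1) := fun n => by
    rw [measure_iUnion_meshEvent hl hs, Measure.restrict_apply (hmE n)]
    refine measure_congr ?_
    filter_upwards [hreg] with p hp
    refine propext (and_iff_left_of_imp fun h => ?_)
    obtain ⟨j, hj⟩ := mem_iUnion.1 h
    exact ⟨hp, cellIndex_lt_of_mem_meshEvent hp hj.1.1 hj.2⟩
  simp only [h3] at h2
  exact tendsto_nhds_unique h1 h2

theorem map_splitLeftmost (hT : MeasurePreserving T posLebesgue posLebesgue) :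
    (poissonLaw posLebesgue).map (splitLeftmost T) =
      productMeasure.restrict (regularLeftmostSet T) := by
  have := Measure.isProbabilityMeasure_map (μ := poissonLaw posLebesgue)
    (measurable_splitLeftmost hT.measurable).aemeasurable
  refine Measure.ext_prod fun {s t} hs ht => ?_
  -- With `s` fixed, the values on rectangles become measures on configurations, to which
  -- `ext_of_counts` applies.
  have h0 : ∀ (m : Measure (PosReal × CountableConfig PosReal)) {t : Set (CountableConfig PosReal)},
      MeasurableSet t → (m.restrict (s ×ˢ univ)).map Prod.snd t = m (s ×ˢ t) := fun m t ht => by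
    rw [Measure.map_apply measurable_snd ht, Measure.restrict_apply (measurable_snd ht)]
    congr 1
    ext p
    simp [and_comm]
  rw [← h0 _ ht, ← h0 _ ht]
  congr 1
  refine ext_of_counts fun ι _ l hl k => ?_
  have hm := measurable_counts hl (measurableSet_singleton k)
  rw [h0 _ hm, h0 _ hm, measure_split_counts hT hl hs]

end split

/-! ### The correspondence between return times to X₀ and leftmost return times -/

section poissonProduct

variable {T : PosReal → PosReal} {p : PosReal × CountableConfig PosReal}

theorem iterate_poissonProduct_fst (k : ℕ) : ((poissonProduct T)^[k] p).1 = T^[k] p.1 := by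
  rw [poissonProduct, Prod.map_iterate]
  rfl

theorem iterate_poissonProduct_mem (h : p.2 ∈ regularConfigs T) (k : ℕ) :
    ((poissonProduct T)^[k] p).2 ∈ regularConfigs T := by
  induction k with
  | zero => exact h
  | succ k ih =>
    rw [Function.iterate_succ_apply']
    exact suspension_mem_regularConfigs ih

/-- Regularity persists along the orbit, so the measurable modification may replace T × T_* there.
-/
theorem iterate_prodMap_regularSuspension (h : p.2 ∈ regularConfigs T) (k : ℕ) :
    (Prod.map T (regularSuspension T))^[k] p = (poissonProduct T)^[k] p := by
  induction k with
  | zero => rfl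
  | succ k ih =>
    rw [Function.iterate_succ_apply', Function.iterate_succ_apply', ih]
    exact Prod.ext rfl (regularSuspension_of_mem (iterate_poissonProduct_mem h k))

theorem iterate_mem_regularLeftmostSet_iff (h : p.2 ∈ regularConfigs T) (k : ℕ) :
    (Prod.map T (regularSuspension T))^[k] p ∈ regularLeftmostSet T ↔
      (poissonProduct T)^[k] p ∈ leftmostSet := by
  rw [iterate_prodMap_regularSuspension h, mem_regularLeftmostSet_iff]
  exact and_iff_right (iterate_poissonProduct_mem h k)

theorem firstReturnTime_poissonProduct (h : p.2 ∈ regularConfigs T) :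
    firstReturnTime (poissonProduct T) leftmostSet p =
      firstReturnTime (Prod.map T (regularSuspension T)) (regularLeftmostSet T) p := by
  simp only [firstReturnTime, iterate_mem_regularLeftmostSet_iff h]

theorem coe_inducedMap_poissonProduct {p : leftmostSet} (h : p.1.2 ∈ regularConfigs T) :
    (inducedMap (poissonProduct T) leftmostSet p : PosReal × CountableConfig PosReal) =
      returnMap (Prod.map T (regularSuspension T)) (regularLeftmostSet T) p := by
  rw [returnMap, iterate_prodMap_regularSuspension h, ← firstReturnTime_poissonProduct h]
  rfl

theorem adjoin_iterate_poissonProduct (k : ℕ) :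
    adjoin ((poissonProduct T)^[k] p) = (suspension T)^[k] (adjoin p) := by
  induction k with
  | zero => rfl
  | succ k ih =>
    rw [Function.iterate_succ_apply', Function.iterate_succ_apply', ← ih]
    ext1
    simp only [adjoin, poissonProduct, suspension, Prod.map, image_union, image_singleton]

theorem iterate_suspension_mem {ω : CountableConfig PosReal} (h : ω ∈ regularConfigs T) (k : ℕ) :
    (suspension T)^[k] ω ∈ regularConfigs T :=
  iterate_poissonProduct_mem (p := (⟨1, mem_Ioi.2 one_pos⟩, ω)) h k |> fun h => by
    rwa [poissonProduct, Prod.map_iterate] at h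

theorem carrier_iterate_poissonProduct (k : ℕ) :
    ((poissonProduct T)^[k] p).2.carrier = T^[k] '' p.2.carrier := by
  induction k with
  | zero => simp
  | succ k ih =>
    rw [Function.iterate_succ_apply', Function.iterate_succ', image_comp, ← ih]
    rfl

theorem isLeast_adjoin (h : p ∈ regularLeftmostSet T) : IsLeast (adjoin p).carrier p.1 := by
  refine ⟨Or.inl rfl, ?_⟩
  rintro y (rfl | hy)
  · exact le_rfl
  · exact h.2.le.trans ((isLeast_leftmostPoint h.1).2 hy)

theorem fst_notMem (h : p ∈ regularLeftmostSet T) : p.1 ∉ p.2.carrier := fun hp =>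
  absurd ((isLeast_leftmostPoint h.1).2 hp) (not_le.2 h.2)

theorem leftmostPoint_adjoin (h : p ∈ regularLeftmostSet T) : leftmostPoint (adjoin p) = p.1 :=
  leftmostPoint_eq_of_isLeast (isLeast_adjoin h)

theorem splitLeftmost_adjoin (h : p ∈ regularLeftmostSet T) (ha : adjoin p ∈ regularConfigs T) :
    splitLeftmost T (adjoin p) = p := by
  rw [splitLeftmost_of_mem ha, leftmostPoint_adjoin h]
  refine Prod.ext rfl (CountableConfig.ext ?_)
  change ({p.1} ∪ p.2.carrier) \ {leftmostPoint (adjoin p)} = p.2.carrier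
  rw [leftmostPoint_adjoin h, union_sdiff_left, sdiff_singleton_eq_self (fst_notMem h)]

theorem adjoin_splitLeftmost {ω : CountableConfig PosReal} (h : ω ∈ regularConfigs T) :
    adjoin (splitLeftmost T ω) = ω := by
  rw [splitLeftmost_of_mem h]
  ext1
  change {leftmostPoint ω} ∪ (ω.carrier \ {leftmostPoint ω}) = ω.carrier
  rw [union_sdiff_self, union_eq_self_of_subset_left
    (singleton_subset_iff.2 (isLeast_leftmostPoint h).1)]

theorem splitLeftmost_mem {ω : CountableConfig PosReal} (h : ω ∈ regularConfigs T) :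
    splitLeftmost T ω ∈ regularLeftmostSet T := by
  rw [splitLeftmost_of_mem h]
  exact ⟨eraseLeftmost_mem_regularConfigs h, leftmostPoint_lt_eraseLeftmost h⟩

/-- T_*^k({x} ∪ ω) consists of T^k x and T_*^kω. Injectivity of T^k on {x} ∪ ω keeps T^k x out of
T_*^kω, so being a least element means being strictly to the left of T_*^kω, which is membership in
X₀. -/
theorem leftmostPoint_iterate_suspension_iff (h : p ∈ regularLeftmostSet T)
    (ha : adjoin p ∈ regularConfigs T) (k : ℕ) :
    leftmostPoint ((suspension T)^[k] (adjoin p)) = T^[k] (leftmostPoint (adjoin p)) ↔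
      (poissonProduct T)^[k] p ∈ leftmostSet := by
  have hreg := iterate_poissonProduct_mem h.1 k
  have hnot : T^[k] p.1 ∉ ((poissonProduct T)^[k] p).2.carrier := by
    rw [carrier_iterate_poissonProduct]
    rintro ⟨y, hy, hyp⟩
    have := injOn_iterate ha k (Or.inr hy) (Or.inl rfl) hyp
    exact fst_notMem h (this ▸ hy)
  rw [leftmostPoint_adjoin h, mem_leftmostSet_iff _ hreg, ← adjoin_iterate_poissonProduct,
    iterate_poissonProduct_fst]
  have hl := isLeast_leftmostPoint hreg
  constructor
  · intro he
    have hl' := isLeast_leftmostPoint (iterate_suspension_mem ha k)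
    rw [← adjoin_iterate_poissonProduct, he] at hl'
    refine lt_of_le_of_ne (hl'.2 (Or.inr hl.1)) fun heq => hnot ?_
    rw [heq]
    exact hl.1
  · intro hlt
    have hq : (poissonProduct T)^[k] p ∈ regularLeftmostSet T :=
      ⟨hreg, by rwa [iterate_poissonProduct_fst]⟩
    rw [leftmostPoint_adjoin hq, iterate_poissonProduct_fst]

theorem leftmostReturnTime_adjoin (h : p ∈ regularLeftmostSet T)
    (ha : adjoin p ∈ regularConfigs T) :
    leftmostReturnTime T (adjoin p) = firstReturnTime (poissonProduct T) leftmostSet p := by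
  simp only [leftmostReturnTime, firstReturnTime, leftmostPoint_iterate_suspension_iff h ha]

theorem leftmostTransformation_adjoin (p : leftmostSet) (h : p.1 ∈ regularLeftmostSet T)
    (ha : adjoin p.1 ∈ regularConfigs T) :
    leftmostTransformation T (adjoin p.1) =
      adjoin (inducedMap (poissonProduct T) leftmostSet p).1 := by
  rw [leftmostTransformation, leftmostReturnTime_adjoin h ha, ← adjoin_iterate_poissonProduct]
  rfl

open Classical in
/-- The map `(x, ω) ↦ {x} ∪ ω` on the regular leftmost pairs, extended by `(x, ω) ↦ ω`. -/
noncomputable def regularAdjoin (T : PosReal → PosReal) :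
    PosReal × CountableConfig PosReal → CountableConfig PosReal :=
  (regularLeftmostSet T).piecewise adjoin Prod.snd

open Classical in
theorem regularAdjoin_of_mem (h : p ∈ regularLeftmostSet T) :
    regularAdjoin T p = adjoin p := by
  rw [regularAdjoin, piecewise_eq_of_mem _ _ _ h]

theorem measurable_regularAdjoin (hT : Measurable T) : Measurable (regularAdjoin T) := by
  classical
  refine measurable_of_count fun B hB => ?_
  have h1 : (fun p => count B (regularAdjoin T p)) = (regularLeftmostSet T).piecewise
      (fun p => count B p.2 + if p.1 ∈ B then 1 else 0) fun p => count B p.2 := by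
    ext1 p
    by_cases h : p ∈ regularLeftmostSet T
    · rw [regularAdjoin_of_mem h, piecewise_eq_of_mem _ _ _ h, count_eq_eraseLeftmost_add
        (by rw [leftmostPoint_adjoin h]; exact Or.inl rfl) B]
      have he : eraseLeftmost (adjoin p) = p.2 := by
        ext1
        change ({p.1} ∪ p.2.carrier) \ {leftmostPoint (adjoin p)} = p.2.carrier
        rw [leftmostPoint_adjoin h, union_sdiff_left, sdiff_singleton_eq_self (fst_notMem h)]
      rw [he, leftmostPoint_adjoin h]
    · rw [regularAdjoin, piecewise_eq_of_notMem _ _ _ h, piecewise_eq_of_notMem _ _ _ h]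
  rw [h1]
  have h2 : Measurable fun p : PosReal × CountableConfig PosReal => count B p.2 :=
    (measurable_count hB).comp measurable_snd
  exact (h2.add (Measurable.ite (measurable_fst hB) measurable_const measurable_const)).piecewise
    (measurableSet_regularLeftmostSet hT) h2

/-- The pairs `p` in the regular leftmost set with `π p` regular that return to it infinitely
often. -/
def recurrentLeftmostSet (T : PosReal → PosReal) : Set (PosReal × CountableConfig PosReal) :=
  {p | p ∈ regularLeftmostSet T ∧ adjoin p ∈ regularConfigs T ∧
    ∃ᶠ n in Filter.atTop, (Prod.map T (regularSuspension T))^[n] p ∈ regularLeftmostSet T}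

theorem measurableSet_recurrentLeftmostSet (hT : Measurable T) :
    MeasurableSet (recurrentLeftmostSet T) := by
  have hS : Measurable (Prod.map T (regularSuspension T)) :=
    hT.prodMap (measurable_regularSuspension hT)
  have hD := measurableSet_regularLeftmostSet hT
  have h1 : recurrentLeftmostSet T = regularLeftmostSet T ∩
      (regularAdjoin T ⁻¹' regularConfigs T ∩ ⋂ a : ℕ, ⋃ b : ℕ, ⋃ (_ : b ≥ a),
        (Prod.map T (regularSuspension T))^[b] ⁻¹' regularLeftmostSet T) := by
    ext p
    refine and_congr_right fun h => ?_
    rw [mem_inter_iff, mem_preimage, regularAdjoin_of_mem h, Filter.frequently_atTop]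
    simp
  rw [h1]
  exact hD.inter ((measurable_regularAdjoin hT (measurableSet_regularConfigs hT)).inter
    (.iInter fun a => .iUnion fun b => .iUnion fun _ => hS.iterate b hD))

theorem returnMap_mem_recurrentLeftmostSet (h : p ∈ recurrentLeftmostSet T) :
    returnMap (Prod.map T (regularSuspension T)) (regularLeftmostSet T) p ∈
      recurrentLeftmostSet T := by
  obtain ⟨k, -, hφ, hk⟩ := exists_returnMap_eq (firstReturnTime_lt_top_of_frequently h.2.2)
  rw [hk]
  refine ⟨(firstReturnTime_eq_coe_iff.1 hφ).1.2, ?_, frequently_iterate_mem_iterate h.2.2 k⟩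
  rw [iterate_prodMap_regularSuspension h.1.1, adjoin_iterate_poissonProduct]
  exact iterate_suspension_mem h.2.1 k

theorem measurePreserving_prodMap (hT : MeasurePreserving T posLebesgue posLebesgue) :
    MeasurePreserving (Prod.map T (regularSuspension T)) productMeasure productMeasure :=
  hT.prod (measurePreserving_regularSuspension hT)

/-- Infinitely many returns come from conservativity of the product. Regularity of {x} ∪ ω holds
almost everywhere because the restricted product measure is the law of `splitLeftmost T`, which
`adjoin` undoes. -/
theorem ae_mem_recurrentLeftmostSet (hT : MeasurePreserving T posLebesgue posLebesgue)
    (hcons : Conservative T posLebesgue) :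
    ∀ᵐ p ∂productMeasure, p ∈ regularLeftmostSet T → p ∈ recurrentLeftmostSet T := by
  have hD := measurableSet_regularLeftmostSet hT.measurable
  have h1 : ∀ᵐ p ∂productMeasure, p ∈ regularLeftmostSet T →
      ∃ᶠ n in Filter.atTop, (Prod.map T (regularSuspension T))^[n] p ∈ regularLeftmostSet T :=
    (hcons.prodMap hT (measurePreserving_regularSuspension hT)).ae_mem_imp_frequently_image_mem
      hD.nullMeasurableSet
  have h2 : ∀ᵐ p ∂productMeasure, p ∈ regularLeftmostSet T →
      regularAdjoin T p ∈ regularConfigs T := by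
    rw [← ae_restrict_iff' hD, ← map_splitLeftmost hT,
      ae_map_iff (measurable_splitLeftmost hT.measurable).aemeasurable
      (measurable_regularAdjoin hT.measurable (measurableSet_regularConfigs hT.measurable))]
    filter_upwards [ae_mem_regularConfigs hT] with ω hω
    rwa [regularAdjoin_of_mem (splitLeftmost_mem hω), adjoin_splitLeftmost hω]
  filter_upwards [h1, h2] with p hp1 hp2 hp
  have := hp2 hp
  rw [regularAdjoin_of_mem hp] at this
  exact ⟨hp, this, hp1 hp⟩

end poissonProduct

/-! ### Transfer to the space X₀ and the isomorphism -/

section leftmostSetMeasure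

/-- Serves for the recurrent pairs, a subtype of a subtype: X₀ is only shown to be null measurable,
but the trace σ-algebra is a pullback and this suffices. -/
theorem measure_eq_of_map_eq {α β : Type*} [mα : MeasurableSpace α] [mβ : MeasurableSpace β]
    {f : α → β} (hf : mα = mβ.comap f) {μ ν : Measure α} (h : μ.map f = ν.map f) : μ = ν := by
  have hfm : Measurable f := fun s hs => hf ▸ ⟨s, hs, rfl⟩
  refine Measure.ext fun s hs => ?_
  rw [hf] at hs
  obtain ⟨t, ht, rfl⟩ := hs
  rw [← Measure.map_apply hfm ht, h, Measure.map_apply hfm ht]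

variable {T : PosReal → PosReal}

theorem ae_mem_leftmostSet_iff (hT : MeasurePreserving T posLebesgue posLebesgue) :
    ∀ᵐ p ∂productMeasure, (p ∈ leftmostSet ↔ p ∈ regularLeftmostSet T) := by
  filter_upwards [Measure.quasiMeasurePreserving_snd.ae (ae_mem_regularConfigs hT)] with p hp
  rw [mem_regularLeftmostSet_iff]
  exact (and_iff_right hp).symm

theorem leftmostSet_ae_eq (hT : MeasurePreserving T posLebesgue posLebesgue) :
    (leftmostSet : Set _) =ᵐ[productMeasure] regularLeftmostSet T := by
  filter_upwards [ae_mem_leftmostSet_iff hT] with p hp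
  exact propext hp

/-- X₀ does not involve a transformation, so the identity serves as the auxiliary measure preserving
map. -/
theorem nullMeasurableSet_leftmostSet : NullMeasurableSet leftmostSet productMeasure :=
  (measurableSet_regularLeftmostSet measurable_id).nullMeasurableSet.congr
    (leftmostSet_ae_eq (.id _)).symm

theorem map_val_leftmostSetMeasure :
    leftmostSetMeasure.map (Subtype.val : leftmostSet → _) =
      productMeasure.restrict leftmostSet := by
  refine Measure.ext fun E hE => ?_
  rw [Measure.map_apply measurable_subtype_coe hE, leftmostSetMeasure,
    Measure.comap_apply₀ _ _ Subtype.val_injective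
      (fun _ => Measure.MeasurableSet.nullMeasurableSet_subtype_coe nullMeasurableSet_leftmostSet)
      (measurable_subtype_coe hE).nullMeasurableSet,
    Subtype.image_preimage_coe, Measure.restrict_apply hE, inter_comm]

theorem map_val_leftmostSetMeasure_eq (hT : MeasurePreserving T posLebesgue posLebesgue) :
    leftmostSetMeasure.map (Subtype.val : leftmostSet → _) =
      productMeasure.restrict (regularLeftmostSet T) := by
  rw [map_val_leftmostSetMeasure, Measure.restrict_congr_set (leftmostSet_ae_eq hT)]

theorem productMeasure_leftmostSet : productMeasure leftmostSet = 1 := by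
  rw [measure_congr (leftmostSet_ae_eq (.id _)), productMeasure_regularLeftmostSet (.id _)]

theorem isProbabilityMeasure_leftmostSetMeasure : IsProbabilityMeasure leftmostSetMeasure := by
  constructor
  rw [← preimage_univ (f := (Subtype.val : leftmostSet → _)),
    ← Measure.map_apply measurable_subtype_coe .univ, map_val_leftmostSetMeasure,
    Measure.restrict_apply_univ, productMeasure_leftmostSet]

theorem ae_leftmostSetMeasure_mem (hT : MeasurePreserving T posLebesgue posLebesgue)
    (hcons : Conservative T posLebesgue) :
    ∀ᵐ p : leftmostSet ∂leftmostSetMeasure, p.1 ∈ recurrentLeftmostSet T := by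
  refine ae_of_ae_map (f := (Subtype.val : leftmostSet → _)) (p := (· ∈ recurrentLeftmostSet T))
    measurable_subtype_coe.aemeasurable ?_
  rw [map_val_leftmostSetMeasure_eq hT,
    ae_restrict_iff' (measurableSet_regularLeftmostSet hT.measurable)]
  exact ae_mem_recurrentLeftmostSet hT hcons

theorem ae_splitLeftmost_mem (hT : MeasurePreserving T posLebesgue posLebesgue)
    (hcons : Conservative T posLebesgue) : ∀ᵐ ω ∂(poissonLaw posLebesgue),
      ω ∈ regularConfigs T ∧ splitLeftmost T ω ∈ recurrentLeftmostSet T := by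
  have h : ∀ᵐ ω ∂(poissonLaw posLebesgue), splitLeftmost T ω ∈ recurrentLeftmostSet T := by
    refine ae_of_ae_map (p := (· ∈ recurrentLeftmostSet T))
      (measurable_splitLeftmost hT.measurable).aemeasurable ?_
    rw [map_splitLeftmost hT,
      ae_restrict_iff' (measurableSet_regularLeftmostSet hT.measurable)]
    exact ae_mem_recurrentLeftmostSet hT hcons
  exact (ae_mem_regularConfigs hT).and h

theorem firstReturnTime_lt_top {p : PosReal × CountableConfig PosReal}
    (h : p ∈ recurrentLeftmostSet T) :
    firstReturnTime (poissonProduct T) leftmostSet p < ⊤ := by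
  rw [firstReturnTime_poissonProduct h.1.1]
  exact firstReturnTime_lt_top_of_frequently h.2.2

theorem map_regularAdjoin (hT : MeasurePreserving T posLebesgue posLebesgue) :
    (productMeasure.restrict (regularLeftmostSet T)).map (regularAdjoin T) =
      poissonLaw posLebesgue := by
  rw [← map_splitLeftmost hT, Measure.map_map (measurable_regularAdjoin hT.measurable)
    (measurable_splitLeftmost hT.measurable)]
  refine (Measure.map_congr ?_).trans Measure.map_id
  filter_upwards [ae_mem_regularConfigs hT] with ω hω
  rw [Function.comp_apply, regularAdjoin_of_mem (splitLeftmost_mem hω), adjoin_splitLeftmost hω]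
  rfl

/-- The configurations whose image under `splitLeftmost` is recurrent. -/
def recurrentConfigs (T : PosReal → PosReal) : Set (CountableConfig PosReal) :=
  {ω | ω ∈ regularConfigs T ∧ splitLeftmost T ω ∈ recurrentLeftmostSet T}

theorem adjoin_mem_recurrentConfigs {p : PosReal × CountableConfig PosReal}
    (h : p ∈ recurrentLeftmostSet T) : adjoin p ∈ recurrentConfigs T :=
  ⟨h.2.1, by rwa [splitLeftmost_adjoin h.1 h.2.1]⟩

theorem measurableSet_recurrentConfigs (hT : Measurable T) :
    MeasurableSet (recurrentConfigs T) :=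
  (measurableSet_regularConfigs hT).inter
    (measurable_splitLeftmost hT (measurableSet_recurrentLeftmostSet hT))

/-- The trace of the recurrent leftmost pairs on `X₀`. -/
def recurrentPairs (T : PosReal → PosReal) : Set leftmostSet :=
  Subtype.val ⁻¹' recurrentLeftmostSet T

theorem mapsTo_inducedMap :
    MapsTo (inducedMap (poissonProduct T) leftmostSet) (recurrentPairs T) (recurrentPairs T) := by
  intro p hp
  change (inducedMap (poissonProduct T) leftmostSet p).1 ∈ recurrentLeftmostSet T
  rw [coe_inducedMap_poissonProduct hp.1.1]
  exact returnMap_mem_recurrentLeftmostSet hp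

theorem mem_leftmostSet_of_mem_recurrent {p : PosReal × CountableConfig PosReal}
    (h : p ∈ recurrentLeftmostSet T) : p ∈ leftmostSet :=
  ((mem_regularLeftmostSet_iff p).1 h.1).2

/-- The map `(x, ω) ↦ {x} ∪ ω`, from the recurrent pairs to the recurrent configurations. -/
noncomputable def adjoinEquiv (hT : Measurable T) : recurrentPairs T ≃ᵐ recurrentConfigs T where
  toFun a := ⟨adjoin a.1.1, adjoin_mem_recurrentConfigs a.2⟩
  invFun b := ⟨⟨splitLeftmost T b.1, mem_leftmostSet_of_mem_recurrent b.2.2⟩, b.2.2⟩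
  left_inv a := Subtype.ext (Subtype.ext (splitLeftmost_adjoin a.2.1 a.2.2.1))
  right_inv b := Subtype.ext (adjoin_splitLeftmost b.2.1)
  measurable_toFun := by
    have h : Measurable fun a : recurrentPairs T => regularAdjoin T a.1.1 :=
      (measurable_regularAdjoin hT).comp (measurable_subtype_coe.comp measurable_subtype_coe)
    refine Measurable.subtype_mk ?_
    have he : (fun a : recurrentPairs T => adjoin a.1.1) = fun a => regularAdjoin T a.1.1 :=
      funext fun a => (regularAdjoin_of_mem a.2.1).symm
    change Measurable fun a : recurrentPairs T => adjoin a.1.1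
    rwa [he]
  measurable_invFun :=
    (((measurable_splitLeftmost hT).comp measurable_subtype_coe).subtype_mk).subtype_mk

theorem mapsTo_leftmostTransformation :
    MapsTo (leftmostTransformation T) (recurrentConfigs T) (recurrentConfigs T) := by
  intro ω hω
  have h1 := leftmostTransformation_adjoin
    ⟨splitLeftmost T ω, mem_leftmostSet_of_mem_recurrent hω.2⟩ hω.2.1 hω.2.2.1
  rw [adjoin_splitLeftmost hω.1] at h1
  rw [h1]
  exact adjoin_mem_recurrentConfigs (mapsTo_inducedMap hω.2)

theorem comap_recurrentPairs : (inferInstance : MeasurableSpace (recurrentPairs T)) =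
    MeasurableSpace.comap (fun a : recurrentPairs T => a.1.1) inferInstance :=
  MeasurableSpace.comap_comp

theorem map_coe_recurrentPairs (hT : MeasurePreserving T posLebesgue posLebesgue)
    (hcons : Conservative T posLebesgue) :
    (leftmostSetMeasure.comap (Subtype.val : recurrentPairs T → leftmostSet)).map
      (fun a : recurrentPairs T => a.1.1) = productMeasure.restrict (regularLeftmostSet T) := by
  have hm : MeasurableSet (recurrentPairs T) :=
    measurable_subtype_coe (measurableSet_recurrentLeftmostSet hT.measurable)
  have h1 := Measure.map_map (μ := leftmostSetMeasure.comap
    (Subtype.val : recurrentPairs T → leftmostSet))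
    (measurable_subtype_coe (p := (· ∈ leftmostSet)))
    (measurable_subtype_coe (p := (· ∈ recurrentPairs T)))
  rw [← map_val_leftmostSetMeasure_eq hT]
  refine h1.symm.trans ?_
  rw [map_comap_subtype_coe hm, Measure.restrict_eq_self_of_ae_mem (s := recurrentPairs T)
    (ae_leftmostSetMeasure_mem hT hcons)]

/-- Through the inclusion into the product space the induced map becomes `returnMap` of the
measurable modification, which preserves the restricted measure. -/
theorem measurePreserving_inducedMap (hT : MeasurePreserving T posLebesgue posLebesgue)
    (hcons : Conservative T posLebesgue) :
    MeasurePreserving (mapsTo_inducedMap (T := T)).restrict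
      (leftmostSetMeasure.comap (Subtype.val : recurrentPairs T → leftmostSet))
      (leftmostSetMeasure.comap (Subtype.val : recurrentPairs T → leftmostSet)) := by
  have hD := measurableSet_regularLeftmostSet hT.measurable
  have hS := measurePreserving_prodMap hT
  have hret := measurePreserving_returnMap hS hD
    (by simp [productMeasure_regularLeftmostSet hT]) (by
      filter_upwards [ae_mem_recurrentLeftmostSet hT hcons] with p hp hpD
      exact firstReturnTime_lt_top_of_frequently (hp hpD).2.2)
  have hι : Measurable fun a : recurrentPairs T => a.1.1 :=
    measurable_subtype_coe.comp measurable_subtype_coe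
  have hcomp : (fun a : recurrentPairs T => a.1.1) ∘ (mapsTo_inducedMap (T := T)).restrict =
      returnMap (Prod.map T (regularSuspension T)) (regularLeftmostSet T) ∘
        fun a : recurrentPairs T => a.1.1 :=
    funext fun a => coe_inducedMap_poissonProduct a.2.1.1
  have hm : Measurable (mapsTo_inducedMap (T := T)).restrict := by
    intro s hs
    have hs' : MeasurableSet[MeasurableSpace.comap (fun a : recurrentPairs T => a.1.1)
      inferInstance] s := comap_recurrentPairs (T := T) ▸ hs
    obtain ⟨E, hE, rfl⟩ := hs'
    rw [← preimage_comp, hcomp]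
    exact (hret.measurable.comp hι) hE
  refine ⟨hm, measure_eq_of_map_eq comap_recurrentPairs ?_⟩
  rw [Measure.map_map hι hm, hcomp, ← Measure.map_map hret.measurable hι,
    map_coe_recurrentPairs hT hcons, hret.map_eq]

theorem measurePreserving_adjoinEquiv (hT : MeasurePreserving T posLebesgue posLebesgue)
    (hcons : Conservative T posLebesgue) :
    MeasurePreserving (adjoinEquiv hT.measurable)
      (leftmostSetMeasure.comap (Subtype.val : recurrentPairs T → leftmostSet))
      ((poissonLaw posLebesgue).comap
        (Subtype.val : recurrentConfigs T → CountableConfig PosReal)) := by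
  refine ⟨(adjoinEquiv hT.measurable).measurable,
    measure_eq_of_map_eq (f := (Subtype.val : recurrentConfigs T → _)) rfl ?_⟩
  have hι : Measurable fun a : recurrentPairs T => a.1.1 :=
    measurable_subtype_coe.comp measurable_subtype_coe
  rw [map_comap_subtype_coe (measurableSet_recurrentConfigs hT.measurable),
    Measure.restrict_eq_self_of_ae_mem (s := recurrentConfigs T) (ae_splitLeftmost_mem hT hcons),
    Measure.map_map measurable_subtype_coe (adjoinEquiv hT.measurable).measurable]
  have h1 : (Subtype.val : recurrentConfigs T → _) ∘ adjoinEquiv hT.measurable =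
      regularAdjoin T ∘ fun a : recurrentPairs T => a.1.1 :=
    funext fun a => (regularAdjoin_of_mem a.2.1).symm
  rw [h1, ← Measure.map_map (measurable_regularAdjoin hT.measurable) hι,
    map_coe_recurrentPairs hT hcons, map_regularAdjoin hT]

theorem adjoinEquiv_restrict (hT : Measurable T) (a : recurrentPairs T) :
    adjoinEquiv hT ((mapsTo_inducedMap (T := T)).restrict _ _ _ a) =
      (mapsTo_leftmostTransformation (T := T)).restrict _ _ _ (adjoinEquiv hT a) :=
  Subtype.ext (leftmostTransformation_adjoin a.1 a.2.1 a.2.2.1).symm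

end leftmostSetMeasure

theorem mainTheorem9 (T : PosReal → PosReal)
    (hT : MeasurePreserving T posLebesgue posLebesgue)
    (hcons : Conservative T posLebesgue) :
    -- the leftmost position transformation is well defined
    (∀ᵐ ω ∂(poissonLaw posLebesgue),
      IsLeast ω.carrier (leftmostPoint ω) ∧ leftmostReturnTime T ω < ⊤) ∧
    -- the induced map on `X_0` is well defined
    NullMeasurableSet leftmostSet productMeasure ∧
    (∀ᵐ p : leftmostSet ∂leftmostSetMeasure,
      firstReturnTime (poissonProduct T) leftmostSet p.1 < ⊤) ∧
    -- the two systems are isomorphic, via `(x, ω) ↦ {x} ∪ ω`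
    IsSystemIsomorphism
      leftmostSetMeasure (inducedMap (poissonProduct T) leftmostSet)
      (poissonLaw posLebesgue) (leftmostTransformation T)
      (fun p : leftmostSet => CountableConfig.adjoin (p : PosReal × CountableConfig PosReal)) ∧
    -- `X_0` is a probability space
    productMeasure leftmostSet = 1 ∧ IsProbabilityMeasure leftmostSetMeasure := by
  refine ⟨?_, nullMeasurableSet_leftmostSet, ?_, ?_, productMeasure_leftmostSet,
    isProbabilityMeasure_leftmostSetMeasure⟩
  · filter_upwards [ae_splitLeftmost_mem hT hcons] with ω hω
    refine ⟨isLeast_leftmostPoint hω.1, ?_⟩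
    have h := leftmostReturnTime_adjoin hω.2.1 hω.2.2.1
    rw [adjoin_splitLeftmost hω.1] at h
    rw [h]
    exact firstReturnTime_lt_top hω.2
  · filter_upwards [ae_leftmostSetMeasure_mem hT hcons] with p hp
    exact firstReturnTime_lt_top hp
  · have he := measurePreserving_adjoinEquiv hT hcons
    have hA := measurePreserving_inducedMap hT hcons
    refine ⟨recurrentPairs T, recurrentConfigs T, mapsTo_inducedMap, mapsTo_leftmostTransformation,
      adjoinEquiv hT.measurable,
      measurable_subtype_coe (measurableSet_recurrentLeftmostSet hT.measurable),
      measurableSet_recurrentConfigs hT.measurable, ae_leftmostSetMeasure_mem hT hcons,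
      ae_splitLeftmost_mem hT hcons, hA, ?_, he, fun _ => rfl, adjoinEquiv_restrict hT.measurable⟩
    -- The restricted leftmost transformation is the conjugate of the induced map by `adjoinEquiv`,
    -- from which it inherits measurability and invariance.
    convert (he.comp hA).comp (MeasurePreserving.symm _ he) using 1
    funext b
    rw [Function.comp_apply, Function.comp_apply, adjoinEquiv_restrict,
      MeasurableEquiv.apply_symm_apply]
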